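/- Let $d\ge 1$ and let $V\in C^\infty(\mathbb R^d,\mathbb R)$ be bounded together with all its partial derivatives, with $-1+\delta\le V\le-\delta$ on $\mathbb R^d$ for some $\delta\in(0,1)$. Let $G(x)=(1-V^2(x))\mathbb 1_d$ be the Agmon metric on $\mathbb R^d$, $d_A$ its Riemannian distance and $\exp_y$ its exponential map at $y$. Let $x_\star\ne y_\star$ be points such that, up to reparametrization, there is a unique minimizing $G$-geodesic from $y_\star$ to $x_\star$, and such that $\exp_{y_\star}'(\exp_{y_\star}^{-1}(x_\star))$ is invertible; here $\exp_{y_\star}^{-1}(x_\star)$ denotes the initial velocity of that geodesic when it is affinely parametrized by $[0,1]$. Let $H(x,p)=-\sqrt{1-|p|^2}-V(x)$ for $|p|<1$. Let $\tau>0$ and let $(\gamma,\varpi):[0,\tau]\to\mathbb R^{2d}$ be a solution of $\dot\gamma=\nabla_pH(\gamma,\varpi)$, $\dot\varpi=-\nabla_xH(\gamma,\varpi)$ with $|\varpi|<1$, $H(\gamma,\varpi)=0$, $\gamma(0)=y_\star$, $\gamma(\tau)=x_\star$, such that $\gamma$ is minimizing, i.e. its $G$-length is $d_A(x_\star,y_\star)$.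 Put $v_{y_\star}=\dot\gamma(0)$ and $v_{x_\star}=\dot\gamma(\tau)$. Let $\varphi\in C^\infty(\mathbb R^d,\mathbb R)$ be bounded together with all its partial derivatives, and such that $|\nabla\varphi|<1$ and $H(x,\nabla\varphi(x))\le 0$ on $\mathbb R^d$, with equality exactly for $x$ in a compact neighbourhood $K_0$ of $\gamma([0,\tau])$, and $\varphi(x)-\varphi(y_\star)=d_A(x,y_\star)$ for $x\in\gamma([0,\tau])$. Extend $V$ and $\varphi$ almost analytically to smooth functions $\mathbb C^d\to\mathbb C$, denoted by the same symbols; that is, all derivatives of $\nabla_{\bar x}V$ and $\nabla_{\bar x}\varphi$ are $O(|\operatorname{Im}x|^N)$ on compact sets, for every $N\in\mathbb N$. Let $$a_+(x,\xi)=-i\sqrt{1+(\xi+i\nabla\varphi(x))^2}-iV(x)$$ on an open neighbourhood $\Omega\subset\mathbb C^{2d}$ of $\mathbb R^{2d}$ on which the argument of the root avoids $(-\infty,0]$, where $\zeta^2=\sum_k\zeta_k^2$, the root is the principal one, and $\nabla_x,\nabla_\xi,d_\eta$ denote the complex derivatives $\frac12(\partial_{\operatorname{Re}}-i\partial_{\operatorname{Im}})$.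 Let $(Q^+,\Xi^+)(t,y,\eta)$ be the flow on $\Omega$ of $\dot Q=\nabla_\xi a_+(Q,\Xi)$, $\dot\Xi=-\nabla_xa_+(Q,\Xi)$ with initial value $(y,\eta)$ at $t=0$. Then $Q^+(\tau,y_\star,\cdot)$ is defined near $\eta=0$ and differentiable at $\eta=0$, $\exp_{y_\star}$ is defined near $\exp_{y_\star}^{-1}(x_\star)$ and differentiable there, with value $x_\star$, and $$\det\begin{pmatrix}0&-v_{y_\star}^{\top}\\ v_{x_\star}& i\,d_\eta Q^+(\tau,y_\star,0)\end{pmatrix} =\frac{d_A(x_\star,y_\star)^{d-1}\,\det\big(\exp_{y_\star}'(\exp_{y_\star}^{-1}(x_\star))\big)}{|V(x_\star)|\,|V(y_\star)|\,(1-V^2(x_\star))^{\frac{d-2}{2}}(1-V^2(y_\star))^{\frac{d-2}{2}}},$$ where the determinant on the right is the Riemannian one, i.e. that of the matrix of $\exp_{y_\star}'(\exp_{y_\star}^{-1}(x_\star)):T_{y_\star}\mathbb R^d\to T_{x_\star}\mathbb R^d$ with respect to positively oriented orthonormal bases of $(T_{y_\star}\mathbb R^d,G(y_\star))$ and $(T_{x_\star}\mathbb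 R^d,G(x_\star))$. -/

import Mathlib

open scoped ContDiff

noncomputable section

/-- Euclidean space `ℝ^d`. -/
abbrev RSp (d : ℕ) := EuclideanSpace ℝ (Fin d)

/-- `ℂ^d` with its Hermitian norm. -/
abbrev CSp (d : ℕ) := EuclideanSpace ℂ (Fin d)

/-- A smooth function all of whose partial derivatives, of any order `≥ 0`, are bounded. -/
def SmoothBounded {d : ℕ} (f : RSp d → ℝ) : Prop :=
  ContDiff ℝ ∞ f ∧ ∀ n : ℕ, ∃ C : ℝ, ∀ x, ‖iteratedFDeriv ℝ n f x‖ ≤ C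

/-- The standing assumptions on the potential: smooth, bounded together with all its
derivatives, and with values in `[-1 + δ, -δ]` for some `δ ∈ (0, 1)`. -/
def PotentialHyp {d : ℕ} (V : RSp d → ℝ) : Prop :=
  SmoothBounded V ∧ ∃ δ : ℝ, 0 < δ ∧ δ < 1 ∧ ∀ x, -1 + δ ≤ V x ∧ V x ≤ -δ

/-! ### The flow of a vector field on an open set -/

/-- `c` is an integral curve of the field `F` inside `Ω` on the interval between `0` and `t`,
starting at `ρ`. -/
def IsIntegralCurveFrom {W : Type*} [NormedAddCommGroup W] [NormedSpace ℝ W]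
    (F : W → W) (Ω : Set W) (t : ℝ) (ρ : W) (c : ℝ → W) : Prop :=
  c 0 = ρ ∧ ∀ s ∈ Set.uIcc 0 t, c s ∈ Ω ∧ HasDerivWithinAt c (F (c s)) (Set.uIcc 0 t) s

/-- `(t, ρ)` lies in the domain of the maximal flow of `F` on `Ω`. -/
def InFlowDomain {W : Type*} [NormedAddCommGroup W] [NormedSpace ℝ W]
    (F : W → W) (Ω : Set W) (t : ℝ) (ρ : W) : Prop :=
  ∃ c : ℝ → W, IsIntegralCurveFrom F Ω t ρ c

open Classical in
/-- The flow of `F` on `Ω`: the value at time `t` of the integral curve starting at `ρ`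
(the junk value `ρ` outside the domain of the flow). -/
def flowAt {W : Type*} [NormedAddCommGroup W] [NormedSpace ℝ W]
    (F : W → W) (Ω : Set W) (t : ℝ) (ρ : W) : W :=
  if h : InFlowDomain F Ω t ρ then h.choose t else ρ

/-! ### The Agmon metric -/

/-- The Agmon metric `G(x) = (1 - V(x)²) 𝟙`. -/
def agmonG {d : ℕ} (V : RSp d → ℝ) (x : RSp d) : Matrix (Fin d) (Fin d) ℝ :=
  (1 - V x ^ 2) • (1 : Matrix (Fin d) (Fin d) ℝ)

/-- The scalar product `⟨v, G(x) w⟩` on the tangent space at `x`. -/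
def agmonInner {d : ℕ} (V : RSp d → ℝ) (x v w : RSp d) : ℝ :=
  ∑ i, ∑ j, v i * agmonG V x i j * w j

/-- The Agmon length of the curve `q` on `[a, b]`. -/
def agmonLength {d : ℕ} (V : RSp d → ℝ) (q : ℝ → RSp d) (a b : ℝ) : ℝ :=
  ∫ t in a..b, √(agmonInner V (q t) (deriv q t) (deriv q t))

/-- `q` is continuous and piecewise smooth on `[0, b]`, with finitely many break points `s`;
it is smooth up to the end points on each piece. -/
def PiecewiseSmooth {d : ℕ} (q : ℝ → RSp d) (b : ℝ) : Prop :=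
  ContinuousOn q (Set.Icc 0 b) ∧ ∃ s : Finset ℝ, ∀ a c : ℝ, 0 ≤ a → a < c → c ≤ b →
    (∀ u ∈ s, u ∉ Set.Ioo a c) → ContDiffOn ℝ ∞ q (Set.Icc a c)

/-- The Agmon distance. -/
def agmonDist {d : ℕ} (V : RSp d → ℝ) (x y : RSp d) : ℝ :=
  sInf {L : ℝ | ∃ b : ℝ, 0 < b ∧ ∃ q : ℝ → RSp d,
    PiecewiseSmooth q b ∧ q 0 = y ∧ q b = x ∧ L = agmonLength V q 0 b}

/-- `∂_l G_{ij}` at `x`. -/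
def agmonGDeriv {d : ℕ} (V : RSp d → ℝ) (x : RSp d) (l i j : Fin d) : ℝ :=
  fderiv ℝ (fun z => agmonG V z i j) x (EuclideanSpace.single l 1)

/-- The Christoffel symbols `Γ^k_{ij}` of the Levi-Civita connection of `G`. -/
def agmonChristoffel {d : ℕ} (V : RSp d → ℝ) (x : RSp d) (k i j : Fin d) : ℝ :=
  (1 / 2) * ∑ l, (agmonG V x)⁻¹ k l *
    (agmonGDeriv V x i l j + agmonGDeriv V x j l i - agmonGDeriv V x l i j)

/-- The geodesic vector field on `T ℝ^d = ℝ^d × ℝ^d`: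
`q̇ = w`, `ẇ^k = - ∑ Γ^k_{ij}(q) w^i w^j`. -/
def geodesicField {d : ℕ} (V : RSp d → ℝ) (ρ : RSp d × RSp d) : RSp d × RSp d :=
  (ρ.2, WithLp.toLp 2 fun k =>
    -∑ i, ∑ j, agmonChristoffel V ρ.1 k i j * ρ.2 i * ρ.2 j)

/-- The exponential map `exp_y` of the Agmon metric. -/
def agmonExp {d : ℕ} (V : RSp d → ℝ) (y v : RSp d) : RSp d :=
  (flowAt (geodesicField V) Set.univ 1 (y, v)).1

/-- `q` is a minimizing Agmon geodesic from `y` to `x`, in its affine parametrization by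
`[0, 1]`. -/
def IsMinGeodesic {d : ℕ} (V : RSp d → ℝ) (y x : RSp d) (q : ℝ → RSp d) : Prop :=
  (∃ w : ℝ → RSp d, ∀ s ∈ Set.Icc (0 : ℝ) 1,
    HasDerivWithinAt (fun r => (q r, w r)) (geodesicField V (q s, w s)) (Set.Icc 0 1) s) ∧
  q 0 = y ∧ q 1 = x ∧ agmonLength V q 0 1 = agmonDist V x y

open Classical in
/-- `exp_y⁻¹(x)`: the initial velocity of the minimizing geodesic `[0, 1] → ℝ^d` from `y`
to `x` (used only where that geodesic is unique). -/
def agmonLog {d : ℕ} (V : RSp d → ℝ) (y x : RSp d) : RSp d :=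
  if h : ∃ q, IsMinGeodesic V y x q then derivWithin h.choose (Set.Icc 0 1) 0 else 0

/-- `x ≠ y`, up to reparametrization there is a unique minimizing geodesic from `y` to `x`,
and `x`, `y` are not conjugate (along that geodesic). -/
def GeodesicHyp {d : ℕ} (V : RSp d → ℝ) (x y : RSp d) : Prop :=
  x ≠ y ∧
  (∃ q, IsMinGeodesic V y x q ∧
    ∀ q', IsMinGeodesic V y x q' → Set.EqOn q q' (Set.Icc 0 1)) ∧
  Function.Bijective (fderiv ℝ (agmonExp V y) (agmonLog V y x))

/-- The `G(x)`-orthonormal, positively oriented frame `(1 - V(x)²)^{-1/2} e_i` at `x`. -/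
def agmonFrame {d : ℕ} (V : RSp d → ℝ) (x : RSp d) (i : Fin d) : RSp d :=
  (√(1 - V x ^ 2))⁻¹ • EuclideanSpace.single i (1 : ℝ)

/-- The Riemannian determinant of a linear map `L : T_y ℝ^d → T_x ℝ^d`, that is, the
determinant of the matrix of `L` with respect to positively oriented orthonormal bases of
`(T_y ℝ^d, G(y))` and `(T_x ℝ^d, G(x))`. -/
def agmonDet {d : ℕ} (V : RSp d → ℝ) (y x : RSp d) (L : RSp d →L[ℝ] RSp d) : ℝ :=
  Matrix.det (Matrix.of fun i j => agmonInner V x (agmonFrame V x i) (L (agmonFrame V y j)))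

/-! ### The Hamilton function and its real trajectories -/

/-- `H(x, p) = -√(1 - |p|²) - V(x)`, considered for `|p| < 1`. -/
def diracHam {d : ℕ} (V : RSp d → ℝ) (x p : RSp d) : ℝ :=
  -√(1 - ‖p‖ ^ 2) - V x

/-- `(γ, ϖ) : [0, τ] → ℝ^{2d}` solves the Hamiltonian equations of `H` with `|ϖ| < 1` and has
energy zero. -/
def IsZeroEnergyTrajectory {d : ℕ} (V : RSp d → ℝ) (τ : ℝ) (γ ϖ : ℝ → RSp d) : Prop :=
  ∀ t ∈ Set.Icc 0 τ,
    ‖ϖ t‖ < 1 ∧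
    HasDerivWithinAt γ (gradient (fun p => diracHam V (γ t) p) (ϖ t)) (Set.Icc 0 τ) t ∧
    HasDerivWithinAt ϖ (-gradient (fun x => diracHam V x (ϖ t)) (γ t)) (Set.Icc 0 τ) t ∧
    diracHam V (γ t) (ϖ t) = 0

/-- `φ` is an Agmon weight for the geodesic segment `S` emanating from `y`, with contact set
`K₀`: `φ` is smooth with bounded derivatives, `|∇φ| < 1`, `H(·, ∇φ) ≤ 0` with equality
exactly on the compact neighbourhood `K₀` of `S`, and `φ(x) - φ(y) = d_A(x, y)` on `S`. -/
def IsAgmonWeight {d : ℕ} (V : RSp d → ℝ) (y : RSp d) (S K₀ : Set (RSp d))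
    (φ : RSp d → ℝ) : Prop :=
  SmoothBounded φ ∧ IsCompact K₀ ∧ S ⊆ interior K₀ ∧
  (∀ x, ‖gradient φ x‖ < 1 ∧ diracHam V x (gradient φ x) ≤ 0 ∧
    (diracHam V x (gradient φ x) = 0 ↔ x ∈ K₀)) ∧
  ∀ x ∈ S, φ x - φ y = agmonDist V x y

/-! ### Almost analytic extensions and the complex Hamiltonian flow -/

/-- The inclusion `ℝ^d ⊆ ℂ^d`. -/
def realToC {d : ℕ} (x : RSp d) : CSp d := WithLp.toLp 2 fun i => (x i : ℂ)

/-- The imaginary part of a vector in `ℂ^d`. -/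
def imVec {d : ℕ} (z : CSp d) : RSp d := WithLp.toLp 2 fun i => (z i).im

/-- `∇_z f = (∇_{Re z} f - i ∇_{Im z} f) / 2`. -/
def wGrad {d : ℕ} (f : CSp d → ℂ) (z : CSp d) : CSp d :=
  WithLp.toLp 2 fun k =>
    (1 / 2 : ℂ) * (fderiv ℝ f z (EuclideanSpace.single k 1)
      - Complex.I * fderiv ℝ f z (EuclideanSpace.single k Complex.I))

/-- `∇_{z̄} f = (∇_{Re z} f + i ∇_{Im z} f) / 2`. -/
def wGradBar {d : ℕ} (f : CSp d → ℂ) (z : CSp d) : CSp d :=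
  WithLp.toLp 2 fun k =>
    (1 / 2 : ℂ) * (fderiv ℝ f z (EuclideanSpace.single k 1)
      + Complex.I * fderiv ℝ f z (EuclideanSpace.single k Complex.I))

/-- The matrix `d_z f = (d_{Re z} f - i d_{Im z} f) / 2` of a map `f : ℂ^d → ℂ^d`. -/
def wJacobian {d : ℕ} (f : CSp d → CSp d) (z : CSp d) : Matrix (Fin d) (Fin d) ℂ :=
  Matrix.of fun j k =>
    (1 / 2 : ℂ) * (fderiv ℝ f z (EuclideanSpace.single k 1) j
      - Complex.I * fderiv ℝ f z (EuclideanSpace.single k Complex.I) j)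

/-- `fc : ℂ^d → ℂ` is an almost analytic extension of `f : ℝ^d → ℝ`: it is smooth, extends `f`,
and all partial derivatives of `∇_{z̄} fc` are `O(|Im z|^N)` on compact sets, for every `N`. -/
def IsAlmostAnalyticExtension {d : ℕ} (f : RSp d → ℝ) (fc : CSp d → ℂ) : Prop :=
  ContDiff ℝ ∞ fc ∧ (∀ x, fc (realToC x) = (f x : ℂ)) ∧
  ∀ K : Set (CSp d), IsCompact K → ∀ N n : ℕ, ∃ C : ℝ, ∀ z ∈ K,
    ‖iteratedFDeriv ℝ n (wGradBar fc) z‖ ≤ C * ‖imVec z‖ ^ N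

/-- `1 + (ξ + i∇φ(x))²`, where `ζ² = ∑ ζ_k²` is the bilinear square. -/
def symbolRadicand {d : ℕ} (φc : CSp d → ℂ) (x ξ : CSp d) : ℂ :=
  1 + ∑ k, (ξ k + Complex.I * wGrad φc x k) ^ 2

/-- `a_+(x, ξ) = -i √(1 + (ξ + i∇φ(x))²) - i V(x)`, with the principal branch of the root. -/
def symbolAPlus {d : ℕ} (Vc φc : CSp d → ℂ) (x ξ : CSp d) : ℂ :=
  -Complex.I * symbolRadicand φc x ξ ^ (1 / 2 : ℂ) - Complex.I * Vc x

/-- `Ω ⊆ ℂ^{2d}` is an open neighbourhood of `ℝ^{2d}` on which the root in `a_+` is well-defined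
(its argument avoids `(-∞, 0]`). -/
def IsSymbolDomain {d : ℕ} (φc : CSp d → ℂ) (Ω : Set (CSp d × CSp d)) : Prop :=
  IsOpen Ω ∧ (∀ x ξ : RSp d, (realToC x, realToC ξ) ∈ Ω) ∧
  ∀ ρ ∈ Ω, symbolRadicand φc ρ.1 ρ.2 ∈ Complex.slitPlane

/-- The (real) Hamiltonian vector field of `a_+` on `ℂ^{2d}`: `(∇_ξ a_+, -∇_x a_+)`. -/
def complexHamField {d : ℕ} (Vc φc : CSp d → ℂ) (ρ : CSp d × CSp d) : CSp d × CSp d :=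
  (wGrad (fun ξ => symbolAPlus Vc φc ρ.1 ξ) ρ.2,
    -wGrad (fun x => symbolAPlus Vc φc x ρ.2) ρ.1)

/-- The position component `Q^+(t, y, η)` of the flow of the Hamiltonian vector field of `a_+`. -/
def qPlus {d : ℕ} (Vc φc : CSp d → ℂ) (Ω : Set (CSp d × CSp d)) (t : ℝ) (y η : CSp d) : CSp d :=
  (flowAt (complexHamField Vc φc) Ω t (y, η)).1

/-- The bordered matrix `[[0, -vᵀ], [u, A]]`. -/
def borderedMatrix {d : ℕ} (v u : RSp d) (A : Matrix (Fin d) (Fin d) ℂ) :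
    Matrix (Unit ⊕ Fin d) (Unit ⊕ Fin d) ℂ :=
  Matrix.fromBlocks 0 (Matrix.of fun _ j => -(v j : ℂ)) (Matrix.of fun i _ => (u i : ℂ)) A

end

/-! Substituting ξ = i(p − ∇φ(x)) turns ξ + i∇φ into ip, so that a_+ becomes iH(x, p). Accordingly
the embedding (x, p) ↦ (x, i(p − ∇φ(x))) carries the real Hamiltonian flow of H into the flow of a_+
(`explicitField_phaseEmbedding`). Since γ is minimizing and |∇φ|² ≤ 1 − V², the growth of φ along γ
is extremal, which forces ϖ = ∇φ(γ) (`IsShellCurve.gradient_eq`). So η = 0 corresponds to p = ϖ(0),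
and for p near ϖ(0) the point Q^+(τ, y, i(p − ϖ(0))) is the real end point X(p) of the H-trajectory
from (y, p). The extensions being almost analytic, the linearized complex flow along a real curve is
complex linear (`exists_hasFDerivAt_qPlus`). Hence i d_ηQ^+ is the real matrix A = X'(ϖ(0)).

Write g = 1 − V². On the shell H = 0 one has |p|² = g, and trajectories are geodesics up to the time
change ds = (g/(−V)) dt, where s is Agmon length (`IsShellCurve.exists_geodesic`). So X(p) =
exp_y((S(p)/g(y)) p) on the sphere |p|² = g(y), with S(p) the length of the trajectory. Let L be the
differential of exp_y at the logarithm, and D the distance. Differentiating along the sphere gives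
Aθ = (D/g(y)) Lθ + a multiple of Lϖ(0), for θ ⟂ ϖ(0). Moreover v_x is a multiple of Lϖ(0), and v_y
one of ϖ(0).

The bordered determinant does not see the value of A on ϖ(0), nor multiples of Lϖ(0) in its columns.
It therefore depends on L alone (`det_bordered`) and equals g(x)/(V(x)V(y)) · (D/g(y))^(d−1) · det
L. Passing to orthonormal frames (`agmonDet_eq`) yields the formula. -/

open scoped ContDiff RealInnerProductSpace
open Set Filter Topology

/-! ### Flows of `C¹` fields: uniqueness, differentiability, linearization -/

section Flow

variable {W : Type*} [NormedAddCommGroup W] [NormedSpace ℝ W]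

lemma isIntegralCurveFrom_iff {F : W → W} {Ω : Set W} {T : ℝ} (hT : 0 ≤ T) {ρ : W} {c : ℝ → W} :
    IsIntegralCurveFrom F Ω T ρ c ↔
      c 0 = ρ ∧ ∀ s ∈ Icc 0 T, c s ∈ Ω ∧ HasDerivWithinAt c (F (c s)) (Icc 0 T) s := by
  rw [IsIntegralCurveFrom, uIcc_of_le hT]

/-- The Gronwall and uniqueness theorems for differential equations ask for right derivatives. -/
lemma HasDerivWithinAt.Ici_of_Icc {c : ℝ → W} {c' : W} {a b t : ℝ} (ht : t ∈ Ico a b)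
    (h : HasDerivWithinAt c c' (Icc a b) t) : HasDerivWithinAt c c' (Ici t) t :=
  h.mono_of_mem_nhdsWithin (mem_of_superset (Icc_mem_nhdsGE ht.2) (Icc_subset_Icc_left ht.1))

/-- Global existence for a bounded, Lipschitz, time-dependent field. -/
lemma exists_integralCurve_of_bounded [CompleteSpace W] {f : ℝ → W → W} {T : ℝ} (hT : 0 ≤ T)
    {K L : NNReal} (hlip : ∀ t ∈ Icc 0 T, LipschitzWith K (f t))
    (hcont : ∀ x, ContinuousOn (f · x) (Icc 0 T)) (hbd : ∀ t ∈ Icc 0 T, ∀ x, ‖f t x‖ ≤ L) (ρ : W) :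
    ∃ c : ℝ → W, c 0 = ρ ∧ ∀ t ∈ Icc 0 T, HasDerivWithinAt c (f t (c t)) (Icc 0 T) t := by
  have h : IsPicardLindelof f (tmin := 0) (tmax := T) ⟨0, left_mem_Icc.2 hT⟩ ρ
      (L * ⟨T, hT⟩) 0 L K :=
    { lipschitzOnWith := fun t ht => (hlip t ht).lipschitzOnWith
      continuousOn := fun x _ => hcont x
      norm_le := fun t ht x _ => hbd t ht x
      mul_max_le := by
        simp only [sub_zero, sub_self, max_eq_left hT, NNReal.coe_zero]
        exact le_rfl }
  exact h.exists_eq_forall_mem_Icc_hasDerivWithinAt₀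

/-- A smooth function with compact support inside `Ω`, equal to one near the compact set `S`. -/
lemma exists_bump_of_isCompact [FiniteDimensional ℝ W] {Ω S : Set W} (hΩ : IsOpen Ω)
    (hS : IsCompact S) (hSΩ : S ⊆ Ω) :
    ∃ χ : W → ℝ, ContDiff ℝ ∞ χ ∧ HasCompactSupport χ ∧ tsupport χ ⊆ Ω ∧
      (∀ᶠ x in 𝓝ˢ S, χ x = 1) ∧ ∀ x, χ x ∈ Icc (0 : ℝ) 1 := by
  obtain ⟨L, hL, hSL, hLΩ⟩ := exists_compact_between hS hΩ hSΩ
  obtain ⟨f, hf1, hf0, hf⟩ := exists_contMDiffMap_one_nhds_of_subset_interior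
    (n := ⊤) (modelWithCornersSelf ℝ W) hS.isClosed hSL
  have hts : tsupport f ⊆ L := closure_minimal
    (fun x hx => by by_contra h; exact hx (hf0 x h)) hL.isClosed
  exact ⟨f, f.contMDiff.contDiff, hL.of_isClosed_subset isClosed_closure hts,
    hts.trans hLΩ, hf1, hf⟩

/-- A `C¹` field on an open set agrees, near a given compact set, with a compactly supported
`C¹` field on the whole space. -/
lemma exists_cutoff_field [FiniteDimensional ℝ W] {F : W → W} {Ω S : Set W} (hΩ : IsOpen Ω)
    (hF : ContDiffOn ℝ 1 F Ω) (hS : IsCompact S) (hSΩ : S ⊆ Ω) :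
    ∃ G : W → W, ContDiff ℝ 1 G ∧ HasCompactSupport G ∧
      ∃ U, IsOpen U ∧ S ⊆ U ∧ U ⊆ Ω ∧ EqOn G F U := by
  obtain ⟨χ, hχ, hc, hts, h1, -⟩ := exists_bump_of_isCompact hΩ hS hSΩ
  obtain ⟨U, hU, hSU, hU1⟩ := mem_nhdsSet_iff_exists.1 h1
  refine ⟨fun x => χ x • F x, ?_, hc.smul_right, U ∩ Ω, hU.inter hΩ, subset_inter hSU hSΩ,
    inter_subset_right, fun x hx => ?_⟩
  · rw [contDiff_iff_contDiffAt]
    intro x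
    by_cases hx : x ∈ Ω
    · exact ((hχ.of_le (by exact_mod_cast le_top)).contDiffAt).smul (hF.contDiffAt (hΩ.mem_nhds hx))
    · have : (fun x => χ x • F x) =ᶠ[𝓝 x] fun _ => 0 := by
        filter_upwards [(isClosed_tsupport χ).isOpen_compl.mem_nhds fun h => hx (hts h)] with z hz
        rw [image_eq_zero_of_notMem_tsupport hz, zero_smul]
      exact contDiffAt_const.congr_of_eventuallyEq this
  · have : χ x = 1 := hU1 hx.1
    simp [this]

/-- Uniqueness of integral curves of a `C¹` field on an open set. -/
lemma IsIntegralCurveFrom.unique [FiniteDimensional ℝ W] {F : W → W} {Ω : Set W} (hΩ : IsOpen Ω)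
    (hF : ContDiffOn ℝ 1 F Ω) {T : ℝ} (hT : 0 ≤ T) {ρ : W} {b c : ℝ → W}
    (hb : IsIntegralCurveFrom F Ω T ρ b) (hc : IsIntegralCurveFrom F Ω T ρ c) :
    EqOn b c (Icc 0 T) := by
  rw [isIntegralCurveFrom_iff hT] at hb hc
  have hbc : ContinuousOn b (Icc 0 T) := fun t ht => (hb.2 t ht).2.continuousWithinAt
  have hcc : ContinuousOn c (Icc 0 T) := fun t ht => (hc.2 t ht).2.continuousWithinAt
  -- The field is only locally Lipschitz on `Ω`. Cutting it off around both trajectories gives a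
  -- globally Lipschitz field with the same two solutions.
  obtain ⟨G, hG, hGc, U, -, hSU, -, hGF⟩ := exists_cutoff_field hΩ hF
    ((isCompact_Icc.image_of_continuousOn hbc).union (isCompact_Icc.image_of_continuousOn hcc))
    (union_subset (image_subset_iff.2 fun t ht => (hb.2 t ht).1)
      (image_subset_iff.2 fun t ht => (hc.2 t ht).1))
  obtain ⟨K, hK⟩ := hG.lipschitzWith_of_hasCompactSupport hGc one_ne_zero
  refine ODE_solution_unique_of_mem_Icc_right (v := fun _ => G) (s := fun _ => univ) (K := K)
    (fun _ _ => hK.lipschitzOnWith) hbc (fun t ht => ?_) (fun _ _ => mem_univ _) hcc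
    (fun t ht => ?_) (fun _ _ => mem_univ _) (hb.1.trans hc.1.symm)
  · have ht' := Ico_subset_Icc_self ht
    simpa only [hGF (hSU (Or.inl (mem_image_of_mem b ht')))] using
      (hb.2 t ht').2.Ici_of_Icc ht
  · have ht' := Ico_subset_Icc_self ht
    simpa only [hGF (hSU (Or.inr (mem_image_of_mem c ht')))] using
      (hc.2 t ht').2.Ici_of_Icc ht

/-- By uniqueness, the curve selected by choice in `flowAt` may be replaced by any integral curve at
hand. -/
lemma IsIntegralCurveFrom.flowAt_eq [FiniteDimensional ℝ W] {F : W → W} {Ω : Set W}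
    (hΩ : IsOpen Ω) (hF : ContDiffOn ℝ 1 F Ω) {T : ℝ} (hT : 0 ≤ T) {ρ : W} {c : ℝ → W}
    (hc : IsIntegralCurveFrom F Ω T ρ c) : flowAt F Ω T ρ = c T := by
  have h : InFlowDomain F Ω T ρ := ⟨c, hc⟩
  rw [flowAt, dif_pos h]
  exact h.choose_spec.unique hΩ hF hT hc (right_mem_Icc.2 hT)

/-- Solutions of linear differential equations with continuous coefficients exist globally. -/
lemma exists_linear_solution {E : Type*} [NormedAddCommGroup E] [NormedSpace ℝ E]
    [FiniteDimensional ℝ E] {A : ℝ → E →L[ℝ] E} {T : ℝ} (hT : 0 ≤ T)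
    (hA : ContinuousOn A (Icc 0 T)) (v : E) :
    ∃ J : ℝ → E, J 0 = v ∧ ∀ t ∈ Icc 0 T, HasDerivWithinAt J (A t (J t)) (Icc 0 T) t := by
  have : CompleteSpace E := FiniteDimensional.complete ℝ E
  obtain ⟨K, hK⟩ := isCompact_Icc.exists_bound_of_continuousOn hA
  have hK0 : 0 ≤ K := (norm_nonneg _).trans (hK 0 (left_mem_Icc.2 hT))
  -- `R` is the a priori Gronwall bound for the linear equation. Replacing `x` by `χ x • x` makes
  -- the field bounded and Lipschitz without weakening this bound, so the solution stays in the ball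
  -- where `χ = 1` and solves the original equation.
  set R := ‖v‖ * Real.exp (K * T)
  obtain ⟨χ, hχ, hc, -, h1, hχI⟩ := exists_bump_of_isCompact isOpen_univ
    (isCompact_closedBall (0 : E) R) (subset_univ _)
  have hχ1 : ContDiff ℝ 1 χ := hχ.of_le (by exact_mod_cast le_top)
  have hg : ContDiff ℝ 1 fun x : E => χ x • x := hχ1.smul contDiff_id
  have hgc : HasCompactSupport fun x : E => χ x • x := hc.smul_right
  obtain ⟨K', hK'⟩ := hg.lipschitzWith_of_hasCompactSupport hgc one_ne_zero
  obtain ⟨L, hL⟩ := hgc.exists_bound_of_continuous hg.continuous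
  have hL0 : 0 ≤ L := (norm_nonneg _).trans (hL 0)
  obtain ⟨J, hJ0, hJ⟩ := exists_integralCurve_of_bounded (f := fun t x => A t (χ x • x)) hT
    (K := ⟨K, hK0⟩ * K') (L := ⟨K * L, mul_nonneg hK0 hL0⟩)
    (fun t ht => ((A t).lipschitz.weaken (hK t ht)).comp hK')
    (fun x => hA.clm_apply continuousOn_const)
    (fun t ht x => ((A t).le_opNorm _).trans
      (mul_le_mul (hK t ht) (hL x) (norm_nonneg _) hK0)) v
  have hJc : ContinuousOn J (Icc 0 T) := fun t ht => (hJ t ht).continuousWithinAt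
  have hbound : ∀ t ∈ Icc 0 T, ‖J t‖ ≤ R := by
    intro t ht
    have := norm_le_gronwallBound_of_norm_deriv_right_le (δ := ‖v‖) (K := K) (ε := 0) hJc
      (fun s hs => (hJ s (Ico_subset_Icc_self hs)).Ici_of_Icc hs) (by rw [hJ0])
      (fun s hs => by
        rw [add_zero]
        refine ((A s).le_opNorm _).trans (mul_le_mul (hK s (Ico_subset_Icc_self hs)) ?_
          (norm_nonneg _) hK0)
        rw [norm_smul, Real.norm_of_nonneg (hχI _).1]
        exact mul_le_of_le_one_left (norm_nonneg _) (hχI _).2) t ht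
    rw [gronwallBound_ε0, sub_zero] at this
    exact this.trans (mul_le_mul_of_nonneg_left (Real.exp_le_exp.2
      (mul_le_mul_of_nonneg_left ht.2 hK0)) (norm_nonneg _))
  refine ⟨J, hJ0, fun t ht => ?_⟩
  have : χ (J t) = 1 := h1.self_of_nhdsSet _ (mem_closedBall_zero_iff.2 (hbound t ht))
  simpa [this] using hJ t ht

/-- First-order Taylor expansion of a compactly supported `C¹` map with uniform remainder. -/
lemma exists_uniform_taylor {G : W → W} (hG : ContDiff ℝ 1 G) (hGc : HasCompactSupport G)
    {ε : ℝ} (hε : 0 < ε) :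
    ∃ δ > 0, ∀ x u : W, ‖u‖ < δ → ‖G (x + u) - G x - fderiv ℝ G x u‖ ≤ ε * ‖u‖ := by
  have huc : UniformContinuous (fderiv ℝ G) :=
    (hGc.fderiv ℝ).uniformContinuous_of_continuous (hG.continuous_fderiv one_ne_zero)
  obtain ⟨δ, hδ, h⟩ := Metric.uniformContinuous_iff.1 huc ε hε
  refine ⟨δ, hδ, fun x u hu => ?_⟩
  have := (convex_ball x δ).norm_image_sub_le_of_norm_fderiv_le' (𝕜 := ℝ) (f := G)
    (φ := fderiv ℝ G x) (C := ε)
    (fun z _ => hG.differentiable one_ne_zero z)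
    (fun z hz => by rw [← dist_eq_norm]; exact (h (Metric.mem_ball.1 hz)).le)
    (Metric.mem_ball_self hδ) (y := x + u) (by simpa using hu)
  simpa using this

/-- Near the starting point of an integral curve on `[0, T]`, the flow at time `T` is defined; it
is differentiable at that point and its derivative solves the linearized equation. -/
theorem exists_hasFDerivAt_flowAt [FiniteDimensional ℝ W] {F : W → W} {Ω : Set W}
    (hΩ : IsOpen Ω) (hF : ContDiffOn ℝ 1 F Ω) {T : ℝ} (hT : 0 ≤ T) {ρ₀ : W} {c : ℝ → W}
    (hc : IsIntegralCurveFrom F Ω T ρ₀ c) :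
    (∀ᶠ ρ in 𝓝 ρ₀, InFlowDomain F Ω T ρ) ∧
    ∃ J : ℝ → W →L[ℝ] W, J 0 = ContinuousLinearMap.id ℝ W ∧
      (∀ t ∈ Icc 0 T, HasDerivWithinAt J ((fderiv ℝ F (c t)).comp (J t)) (Icc 0 T) t) ∧
      HasFDerivAt (flowAt F Ω T) (J T) ρ₀ := by
  have : CompleteSpace W := FiniteDimensional.complete ℝ W
  have hc' := (isIntegralCurveFrom_iff hT).1 hc
  obtain ⟨hc0, hcd⟩ := hc'
  have hcc : ContinuousOn c (Icc 0 T) := fun t ht => (hcd t ht).2.continuousWithinAt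
  have hcomp : IsCompact (c '' Icc 0 T) := isCompact_Icc.image_of_continuousOn hcc
  obtain ⟨G, hG, hGc, U, hU, hSU, hUΩ, hGF⟩ := exists_cutoff_field hΩ hF hcomp
    (image_subset_iff.2 fun t ht => (hcd t ht).1)
  have hGd : ∀ t ∈ Icc 0 T, fderiv ℝ G (c t) = fderiv ℝ F (c t) := fun t ht =>
    (hGF.eventuallyEq_of_mem (hU.mem_nhds (hSU (mem_image_of_mem c ht)))).fderiv_eq
  have hcG : ∀ t ∈ Icc 0 T, HasDerivWithinAt c (G (c t)) (Icc 0 T) t := fun t ht => by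
    rw [hGF (hSU (mem_image_of_mem c ht))]; exact (hcd t ht).2
  obtain ⟨K, hK⟩ := hG.lipschitzWith_of_hasCompactSupport hGc one_ne_zero
  obtain ⟨L, hL⟩ := hGc.exists_bound_of_continuous hG.continuous
  have hL0 : 0 ≤ L := (norm_nonneg _).trans (hL 0)
  choose α hα0 hα using fun ρ => exists_integralCurve_of_bounded (f := fun _ => G) hT
    (K := K) (L := ⟨L, hL0⟩) (fun _ _ => hK) (fun _ => continuousOn_const) (fun _ _ x => hL x) ρ
  have hαc : ∀ ρ, ContinuousOn (α ρ) (Icc 0 T) := fun ρ t ht => (hα ρ t ht).continuousWithinAt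
  set B := Real.exp (K * T)
  have hexp : ∀ t ∈ Icc 0 T, Real.exp (K * t) ≤ B := fun t ht =>
    Real.exp_le_exp.2 (mul_le_mul_of_nonneg_left ht.2 K.2)
  have hdist : ∀ ρ, ∀ t ∈ Icc 0 T, ‖α ρ t - c t‖ ≤ ‖ρ - ρ₀‖ * B := by
    intro ρ t ht
    have := dist_le_of_trajectories_ODE (v := fun _ => G) (K := K) (fun _ => hK) (hαc ρ)
      (fun s hs => (hα ρ s (Ico_subset_Icc_self hs)).Ici_of_Icc hs) hcc
      (fun s hs => (hcG s (Ico_subset_Icc_self hs)).Ici_of_Icc hs)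
      (δ := ‖ρ - ρ₀‖) (by rw [hα0, hc0, dist_eq_norm]) t ht
    rw [dist_eq_norm, sub_zero] at this
    exact this.trans (mul_le_mul_of_nonneg_left (hexp t ht) (norm_nonneg _))
  have hB : 0 < B := Real.exp_pos _
  obtain ⟨r, hr, hrU⟩ := hcomp.exists_thickening_subset_open hU hSU
  have hcurve : ∀ᶠ ρ in 𝓝 ρ₀, IsIntegralCurveFrom F Ω T ρ (α ρ) := by
    filter_upwards [Metric.ball_mem_nhds ρ₀ (div_pos hr hB)] with ρ hρ
    rw [isIntegralCurveFrom_iff hT]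
    refine ⟨hα0 ρ, fun t ht => ?_⟩
    have hm : α ρ t ∈ U := by
      refine hrU (Metric.mem_thickening_iff.2 ⟨c t, mem_image_of_mem c ht, ?_⟩)
      rw [dist_eq_norm]
      refine (hdist ρ t ht).trans_lt ?_
      rwa [← lt_div_iff₀ hB, ← dist_eq_norm]
    exact ⟨hUΩ hm, by rw [← hGF hm]; exact hα ρ t ht⟩
  refine ⟨hcurve.mono fun ρ h => ⟨_, h⟩, ?_⟩
  have hAc : ContinuousOn (fun t => fderiv ℝ F (c t)) (Icc 0 T) :=
    (((hG.continuous_fderiv one_ne_zero).comp_continuousOn hcc).congr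
      fun t ht => (hGd t ht).symm)
  obtain ⟨J, hJ0, hJ⟩ := exists_linear_solution
    (A := fun t => ContinuousLinearMap.compL ℝ W W W (fderiv ℝ F (c t))) hT
    ((ContinuousLinearMap.continuous _).comp_continuousOn hAc) (ContinuousLinearMap.id ℝ W)
  refine ⟨J, hJ0, hJ, ?_⟩
  have hc0T : flowAt F Ω T ρ₀ = c T := hc.flowAt_eq hΩ hF hT
  rw [hasFDerivAt_iff_isLittleO, Asymptotics.isLittleO_iff]
  intro ε hε
  set N := gronwallBound 0 K 1 T
  have hN0 : 0 ≤ N := by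
    have := gronwallBound_mono (δ := 0) (ε := 1) (K := K) le_rfl zero_le_one K.2 hT
    rwa [gronwallBound_x0] at this
  -- The Taylor remainder along the curve is at most ε/(BN+1) · B‖ρ − ρ₀‖. Gronwall with zero
  -- initial error multiplies it by `N`, and BN/(BN+1) ≤ 1.
  obtain ⟨δ, hδ, htay⟩ := exists_uniform_taylor hG hGc (ε := ε / (B * N + 1)) (by positivity)
  filter_upwards [hcurve, Metric.ball_mem_nhds ρ₀ (div_pos hδ hB)] with ρ hρ hρδ
  rw [hρ.flowAt_eq hΩ hF hT, hc0T]
  have hsmall : ∀ t ∈ Icc 0 T, ‖α ρ t - c t‖ < δ := fun t ht =>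
    (hdist ρ t ht).trans_lt (by rwa [← lt_div_iff₀ hB, ← dist_eq_norm])
  have hed : ∀ t ∈ Icc 0 T, HasDerivWithinAt (fun t => α ρ t - c t - J t (ρ - ρ₀))
      (G (α ρ t) - G (c t) - fderiv ℝ F (c t) (J t (ρ - ρ₀))) (Icc 0 T) t := fun t ht =>
    ((hα ρ t ht).sub (hcG t ht)).sub ((hJ t ht).clm_apply (hasDerivWithinAt_const _ _ _) |>.congr_deriv
      (by simp))
  have hKn : ∀ x, ‖fderiv ℝ G x‖ ≤ K := fun x => norm_fderiv_le_of_lipschitz ℝ hK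
  have key := norm_le_gronwallBound_of_norm_deriv_right_le (δ := 0) (K := K)
    (ε := ε / (B * N + 1) * (‖ρ - ρ₀‖ * B))
    (f := fun t => α ρ t - c t - J t (ρ - ρ₀)) (fun t ht => (hed t ht).continuousWithinAt)
    (fun t ht => (hed t (Ico_subset_Icc_self ht)).Ici_of_Icc ht) (by simp [hα0, hc0, hJ0])
    (fun t ht => by
      have ht := Ico_subset_Icc_self ht
      have h1 := htay (c t) (α ρ t - c t) (hsmall t ht)
      rw [add_sub_cancel, hGd t ht] at h1
      have : G (α ρ t) - G (c t) - fderiv ℝ F (c t) (J t (ρ - ρ₀)) =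
          fderiv ℝ F (c t) (α ρ t - c t - J t (ρ - ρ₀)) +
          (G (α ρ t) - G (c t) - fderiv ℝ F (c t) (α ρ t - c t)) := by
        simp only [map_sub]; abel
      rw [this]
      refine (norm_add_le _ _).trans (add_le_add ?_ (h1.trans ?_))
      · refine ((fderiv ℝ F (c t)).le_opNorm _).trans
          (mul_le_mul_of_nonneg_right ?_ (norm_nonneg _))
        rw [← hGd t ht]; exact hKn _
      · exact mul_le_mul_of_nonneg_left (hdist ρ t ht) (by positivity)) T (right_mem_Icc.2 hT)
  have hlin : ∀ e : ℝ, gronwallBound 0 K e T = e * N := by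
    intro e
    simp only [N, gronwallBound]
    split_ifs <;> ring
  rw [sub_zero, hlin] at key
  refine key.trans ?_
  rw [div_mul_eq_mul_div, div_mul_eq_mul_div, div_le_iff₀ (by positivity)]
  nlinarith [mul_nonneg hε.le (norm_nonneg (ρ - ρ₀))]

/-- Solutions of the linearized equation commute with every constant operator that commutes with
the coefficients. -/
lemma linear_solution_commute {A J : ℝ → W →L[ℝ] W} {T : ℝ} (hT : 0 ≤ T)
    (hA : ContinuousOn A (Icc 0 T)) (hJ0 : J 0 = ContinuousLinearMap.id ℝ W)
    (hJ : ∀ t ∈ Icc 0 T, HasDerivWithinAt J ((A t).comp (J t)) (Icc 0 T) t)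
    (I : W →L[ℝ] W) (hI : ∀ t ∈ Icc 0 T, ∀ v, A t (I v) = I (A t v)) (v : W) :
    J T (I v) = I (J T v) := by
  obtain ⟨K, hK⟩ := isCompact_Icc.exists_bound_of_continuousOn hA
  -- The commutator solves the same linear equation with initial value zero.
  have hd : ∀ t ∈ Icc 0 T, HasDerivWithinAt (fun t => J t (I v) - I (J t v))
      (A t (J t (I v) - I (J t v))) (Icc 0 T) t := by
    intro t ht
    have h1 := (hJ t ht).clm_apply (hasDerivWithinAt_const t (Icc 0 T) (I v))
    have h2 := I.hasFDerivAt.comp_hasDerivWithinAt t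
      ((hJ t ht).clm_apply (hasDerivWithinAt_const t (Icc 0 T) v))
    refine (h1.sub h2).congr_deriv ?_
    simp [hI t ht]
  have := eq_zero_of_abs_deriv_le_mul_abs_self_of_eq_zero_right (K := K)
    (fun t ht => (hd t ht).continuousWithinAt)
    (fun t ht => (hd t (Ico_subset_Icc_self ht)).Ici_of_Icc ht) (by simp [hJ0])
    (fun t ht => (A t).le_of_opNorm_le (hK t (Ico_subset_Icc_self ht)) _)
    T (right_mem_Icc.2 hT)
  exact sub_eq_zero.1 this

end Flow

/-! ### Almost analytic functions and their derivatives at real points -/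

section AlmostHolomorphic

variable {d : ℕ}

/-- The inclusion `ℝ^d ⊆ ℂ^d` as a continuous linear map. -/
noncomputable def realToCL (d : ℕ) : RSp d →L[ℝ] CSp d :=
  LinearMap.toContinuousLinearMap
    { toFun := realToC
      map_add' := fun x y => by ext i; simp [realToC]
      map_smul' := fun c x => by ext i; simp [realToC] }

@[simp] lemma realToCL_apply (x : RSp d) : realToCL d x = realToC x := rfl

@[simp] lemma realToC_apply (x : RSp d) (i : Fin d) : realToC x i = (x i : ℂ) := rfl

lemma realToC_single (k : Fin d) :
    realToC (EuclideanSpace.single k (1 : ℝ)) = EuclideanSpace.single k (1 : ℂ) := by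
  ext i
  rcases eq_or_ne i k with rfl | h <;> simp [*]

lemma I_smul_single (k : Fin d) : Complex.I • EuclideanSpace.single k (1 : ℂ) =
    EuclideanSpace.single k Complex.I := by
  ext i
  rcases eq_or_ne i k with rfl | h <;> simp [*]

lemma imVec_realToC (x : RSp d) : imVec (realToC x) = 0 := by
  ext i; simp [imVec]

/-- All derivatives of `b` vanish on `ℝ^d`. -/
def FlatOnReals {E : Type*} [NormedAddCommGroup E] [NormedSpace ℝ E] (b : CSp d → E) : Prop :=
  ContDiff ℝ ∞ b ∧ ∀ (n : ℕ) (x : RSp d), iteratedFDeriv ℝ n b (realToC x) = 0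

namespace FlatOnReals

variable {E E' : Type*} [NormedAddCommGroup E] [NormedSpace ℝ E] [NormedAddCommGroup E']
  [NormedSpace ℝ E'] {b b' : CSp d → E}

lemma clm_comp (hb : FlatOnReals b) (L : E →L[ℝ] E') : FlatOnReals fun z => L (b z) :=
  ⟨L.contDiff.comp hb.1, fun n x => by
    have := L.iteratedFDeriv_comp_left hb.1.contDiffAt (x := realToC x) (i := n)
      (by exact_mod_cast le_top)
    rw [hb.2] at this
    ext m
    simpa [Function.comp_def] using congrArg (fun q => q m) this⟩

protected lemma fderiv (hb : FlatOnReals b) : FlatOnReals (fderiv ℝ b) :=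
  ⟨hb.1.fderiv_right (by exact_mod_cast le_rfl), fun n x => by
    rw [← norm_eq_zero, norm_iteratedFDeriv_fderiv, hb.2, norm_zero]⟩

lemma add (hb : FlatOnReals b) (hb' : FlatOnReals b') : FlatOnReals fun z => b z + b' z :=
  ⟨hb.1.add hb'.1, fun n x => by
    have h := iteratedFDeriv_add_apply (x := realToC x) (i := n) (f := b) (g := b') (𝕜 := ℝ)
      (hb.1.contDiffAt.of_le (by exact_mod_cast le_top))
      (hb'.1.contDiffAt.of_le (by exact_mod_cast le_top))
    rw [hb.2, hb'.2, add_zero] at h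
    exact h⟩

lemma eq_zero (hb : FlatOnReals b) (x : RSp d) : b (realToC x) = 0 := by
  have := hb.2 0 x
  rwa [← norm_eq_zero, norm_iteratedFDeriv_zero, norm_eq_zero] at this

end FlatOnReals

/-- A smooth function whose antiholomorphic derivatives are flat on `ℝ^d`. -/
def AlmostHolomorphic (f : CSp d → ℂ) : Prop :=
  ContDiff ℝ ∞ f ∧
    ∀ v, FlatOnReals fun z => fderiv ℝ f z (Complex.I • v) - Complex.I * fderiv ℝ f z v

lemma eq_sum_single (v : CSp d) :
    v = ∑ j, ((v j).re • EuclideanSpace.single j (1 : ℂ) +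
      (v j).im • EuclideanSpace.single j Complex.I) := by
  ext i
  simp only [PiLp.add_apply, PiLp.smul_apply, WithLp.ofLp_sum, Finset.sum_apply]
  rw [Finset.sum_eq_single i]
  · simp [Complex.re_add_im]
  · intro j _ h; simp [h.symm]
  · simp

lemma fderiv_eq_sum (L : CSp d →L[ℝ] ℂ) (v : CSp d) :
    L v = ∑ j, (((v j).re : ℂ) * L (EuclideanSpace.single j 1) +
      ((v j).im : ℂ) * L (EuclideanSpace.single j Complex.I)) := by
  conv_lhs => rw [eq_sum_single v]
  simp

/-- The defect of complex linearity is df(iv) − i df(v) = −2i ∑ v̄_j ∂̄_j f, a constant linear image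
of `wGradBar`. The latter is flat: at a real point the bound with exponent `N = 1` already reads
zero for every order of derivative. -/
lemma IsAlmostAnalyticExtension.almostHolomorphic {f : RSp d → ℝ} {fc : CSp d → ℂ}
    (h : IsAlmostAnalyticExtension f fc) : AlmostHolomorphic fc := by
  have hd : ContDiff ℝ ∞ (fderiv ℝ fc) := h.1.fderiv_right (by exact_mod_cast le_rfl)
  have hb : ContDiff ℝ ∞ (wGradBar fc) := by
    rw [contDiff_piLp]
    intro i
    exact contDiff_const.mul ((hd.clm_apply contDiff_const).add
      (contDiff_const.mul (hd.clm_apply contDiff_const)))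
  have hflat : FlatOnReals (wGradBar fc) := by
    refine ⟨hb, fun n x => ?_⟩
    obtain ⟨C, hC⟩ := h.2.2 {realToC x} isCompact_singleton 1 n
    have := hC _ rfl
    rw [imVec_realToC] at this
    simpa using this
  refine ⟨h.1, fun v => ?_⟩
  let L : CSp d →L[ℝ] ℂ := ∑ j, ((-2 * Complex.I * starRingEnd ℂ (v j)) •
    ((EuclideanSpace.proj j : CSp d →L[ℂ] ℂ).restrictScalars ℝ))
  have hL : ∀ b, L b = ∑ j, (-2 * Complex.I * starRingEnd ℂ (v j)) * b j := by
    intro b; simp [L]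
  convert hflat.clm_comp L using 2 with z
  rw [hL, fderiv_eq_sum _ v, fderiv_eq_sum _ (Complex.I • v), Finset.mul_sum,
    ← Finset.sum_sub_distrib]
  refine Finset.sum_congr rfl fun j _ => ?_
  have : starRingEnd ℂ (v j) = (v j).re - (v j).im * Complex.I := by
    apply Complex.ext <;> simp
  simp only [wGradBar, this, PiLp.smul_apply, smul_eq_mul, Complex.mul_re, Complex.mul_im,
    Complex.I_re, Complex.I_im, zero_mul, one_mul, zero_sub, zero_add, Complex.ofReal_neg]
  linear_combination (-((v j).im : ℂ) * (fderiv ℝ fc z) (EuclideanSpace.single j 1)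
    + ((v j).re : ℂ) * (fderiv ℝ fc z) (EuclideanSpace.single j Complex.I)
    - ((v j).im : ℂ) * Complex.I * (fderiv ℝ fc z) (EuclideanSpace.single j Complex.I))
      * Complex.I_sq

namespace AlmostHolomorphic

variable {f g : CSp d → ℂ}

lemma const_mul (hf : AlmostHolomorphic f) (a : ℂ) : AlmostHolomorphic fun z => a * f z := by
  refine ⟨contDiff_const.mul hf.1, fun v => ?_⟩
  convert (hf.2 v).clm_comp (ContinuousLinearMap.mul ℝ ℂ a) using 2 with z
  rw [fderiv_const_mul (hf.1.differentiable (by simp) z)]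
  simp
  ring

lemma add (hf : AlmostHolomorphic f) (hg : AlmostHolomorphic g) :
    AlmostHolomorphic fun z => f z + g z := by
  refine ⟨hf.1.add hg.1, fun v => ?_⟩
  convert (hf.2 v).add (hg.2 v) using 2 with z
  rw [fderiv_fun_add (hf.1.differentiable (by simp) z) (hg.1.differentiable (by simp) z)]
  simp
  ring

/-- By symmetry of second derivatives, the defect of the derivative in direction `w` is the
`w`-derivative of the defect, and flatness survives differentiation. -/
lemma fderiv_apply (hf : AlmostHolomorphic f) (w : CSp d) :
    AlmostHolomorphic fun z => fderiv ℝ f z w := by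
  have hd : ContDiff ℝ ∞ (fderiv ℝ f) := hf.1.fderiv_right (by exact_mod_cast le_rfl)
  have hdd : Differentiable ℝ (fderiv ℝ f) := hd.differentiable (by simp)
  have happ : ∀ u z v, fderiv ℝ (fun z => fderiv ℝ f z u) z v = fderiv ℝ (fderiv ℝ f) z v u := by
    intro u z v
    rw [fderiv_clm_apply (hdd z) (differentiableAt_const u)]
    simp
  have hsymm : ∀ z u v, fderiv ℝ (fderiv ℝ f) z u v = fderiv ℝ (fderiv ℝ f) z v u := fun z u v =>
    (hf.1.contDiffAt.isSymmSndFDerivAt (by simpa using ENat.LEInfty.out)).eq u v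
  refine ⟨hd.clm_apply contDiff_const, fun v => ?_⟩
  convert (hf.2 v).fderiv.clm_comp (ContinuousLinearMap.apply ℝ ℂ w) using 2 with z
  have h1 : DifferentiableAt ℝ (fun z => fderiv ℝ f z (Complex.I • v)) z :=
    (hdd z).clm_apply (differentiableAt_const _)
  have h2 : DifferentiableAt ℝ (fun z => fderiv ℝ f z v) z :=
    (hdd z).clm_apply (differentiableAt_const _)
  rw [fderiv_fun_sub h1 (h2.const_mul _), fderiv_const_mul h2]
  simp only [ContinuousLinearMap.apply_apply, sub_apply,
    smul_apply, happ, smul_eq_mul]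
  rw [hsymm, hsymm z v w]

lemma wGrad_apply (hf : AlmostHolomorphic f) (k : Fin d) :
    AlmostHolomorphic fun z => wGrad f z k := by
  have := ((hf.fderiv_apply (EuclideanSpace.single k 1)).add
    ((hf.fderiv_apply (EuclideanSpace.single k Complex.I)).const_mul (-Complex.I))).const_mul (1 / 2)
  convert this using 2 with z
  simp [wGrad]
  ring

lemma fderiv_I_smul (hf : AlmostHolomorphic f) (x : RSp d) (v : CSp d) :
    fderiv ℝ f (realToC x) (Complex.I • v) = Complex.I * fderiv ℝ f (realToC x) v :=
  sub_eq_zero.1 ((hf.2 v).eq_zero x)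

/-- The defect vanishes at real points, so the real derivative there is complex linear. -/
lemma differentiableAt (hf : AlmostHolomorphic f) (x : RSp d) :
    DifferentiableAt ℂ f (realToC x) := by
  rw [differentiableAt_iff_restrictScalars ℝ (hf.1.differentiable (by simp) _)]
  let L : CSp d →ₗ[ℂ] ℂ :=
    { toFun := fderiv ℝ f (realToC x)
      map_add' := map_add _
      map_smul' := fun c v => by
        have : c • v = c.re • v + c.im • Complex.I • v := by
          ext i
          simp only [PiLp.smul_apply, PiLp.add_apply, smul_eq_mul, Complex.real_smul]
          conv_lhs => rw [← Complex.re_add_im c]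
          ring
        rw [this, map_add, map_smul, map_smul, hf.fderiv_I_smul]
        simp only [Complex.real_smul, smul_eq_mul, RingHom.id_apply]
        conv_rhs => rw [← Complex.re_add_im c]
        ring }
  exact ⟨LinearMap.toContinuousLinearMap L, by ext v; rfl⟩

/-- On `ℝ^d` the complex derivatives of an almost analytic extension are the real derivatives. -/
lemma wGrad_realToC (hf : AlmostHolomorphic f) {f₀ : RSp d → ℝ} (h : ∀ x, f (realToC x) = f₀ x)
    (hf₀ : Differentiable ℝ f₀) (x : RSp d) (k : Fin d) :
    wGrad f (realToC x) k = (fderiv ℝ f₀ x (EuclideanSpace.single k 1) : ℂ) := by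
  have h1 : HasFDerivAt (fun x => f (realToCL d x)) ((fderiv ℝ f (realToC x)).comp (realToCL d)) x :=
    (hf.1.differentiable (by simp) _).hasFDerivAt.comp x (realToCL d).hasFDerivAt
  have h2 : HasFDerivAt (fun x => (f₀ x : ℂ)) (Complex.ofRealCLM.comp (fderiv ℝ f₀ x)) x :=
    Complex.ofRealCLM.hasFDerivAt.comp x (hf₀ x).hasFDerivAt
  have h3 : (fun x => f (realToCL d x)) = fun x => (f₀ x : ℂ) := funext h
  rw [h3] at h1
  have := congrArg (fun L => L (EuclideanSpace.single k 1)) (h1.unique h2)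
  simp only [ContinuousLinearMap.comp_apply, realToCL_apply, realToC_single,
    Complex.ofRealCLM_apply] at this
  simp only [wGrad]
  rw [← I_smul_single, hf.fderiv_I_smul, this]
  linear_combination (-1 / 2 * (fderiv ℝ f₀ x (EuclideanSpace.single k 1) : ℂ)) * Complex.I_sq

end AlmostHolomorphic

end AlmostHolomorphic

/-! ### The Hamiltonian field of a_+ in closed form -/

section ComplexField

variable {d : ℕ}

/-- Both components of the field are instances, as functions of ξ and of x respectively. The chain
rule holds for `wGrad` because the outer function, the principal root, is holomorphic. -/
lemma wGrad_sqrt_symbol {u : Fin d → CSp d → ℂ} {g : CSp d → ℂ} {z : CSp d}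
    (hu : ∀ k, DifferentiableAt ℝ (u k) z) (hg : DifferentiableAt ℝ g z)
    (hz : 1 + ∑ k, u k z ^ 2 ∈ Complex.slitPlane) (j : Fin d) :
    wGrad (fun z => -Complex.I * (1 + ∑ k, u k z ^ 2) ^ (1 / 2 : ℂ) - Complex.I * g z) z j =
      -Complex.I * ((1 + ∑ k, u k z ^ 2) ^ (1 / 2 - 1 : ℂ) * ∑ k, u k z * wGrad (u k) z j)
        - Complex.I * wGrad g z j := by
  have hr : HasFDerivAt (fun z => 1 + ∑ k, u k z ^ 2)
      (∑ k, (2 * u k z) • fderiv ℝ (u k) z) z := by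
    refine HasFDerivAt.const_add _ (HasFDerivAt.fun_sum fun k _ => ?_)
    simpa using (hu k).hasFDerivAt.pow 2
  have hp : HasFDerivAt (fun w : ℂ => w ^ (1 / 2 : ℂ)) _ (1 + ∑ k, u k z ^ 2) :=
    ((hasDerivAt_id _).cpow_const hz).hasFDerivAt.restrictScalars ℝ
  have hq : HasFDerivAt (fun z => (1 + ∑ k, u k z ^ 2) ^ (1 / 2 : ℂ))
      ((1 + ∑ k, u k z ^ 2) ^ (1 / 2 - 1 : ℂ) • ∑ k, u k z • fderiv ℝ (u k) z) z := by
    refine (hp.comp z hr).congr_fderiv ?_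
    ext v
    simp only [ContinuousLinearMap.comp_apply, smul_apply, sum_apply, smul_eq_mul, id,
      ContinuousLinearMap.coe_restrictScalars', ContinuousLinearMap.toSpanSingleton_apply,
      Finset.mul_sum, Finset.sum_mul]
    exact Finset.sum_congr rfl fun k _ => by ring
  have h := ((hq.const_mul (-Complex.I)).fun_sub (hg.hasFDerivAt.const_mul Complex.I)).fderiv
  simp only [wGrad, h, sub_apply, smul_apply, smul_eq_mul, sum_apply]
  have : ∀ k, u k z * (1 / 2 * (fderiv ℝ (u k) z (EuclideanSpace.single j 1) -
      Complex.I * fderiv ℝ (u k) z (EuclideanSpace.single j Complex.I))) =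
      1 / 2 * (u k z * fderiv ℝ (u k) z (EuclideanSpace.single j 1)) - Complex.I * (1 / 2 *
        (u k z * fderiv ℝ (u k) z (EuclideanSpace.single j Complex.I))) := fun k => by ring
  simp only [this, Finset.sum_sub_distrib, ← Finset.mul_sum]
  ring

/-- The components of the Hamiltonian field of `a_+` in closed form. -/
noncomputable def explicitField (Vc φc : CSp d → ℂ) (ρ : CSp d × CSp d) : CSp d × CSp d :=
  (WithLp.toLp 2 fun j => -Complex.I * (symbolRadicand φc ρ.1 ρ.2 ^ (1 / 2 - 1 : ℂ) *
      (ρ.2 j + Complex.I * wGrad φc ρ.1 j)),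
    WithLp.toLp 2 fun j => -(symbolRadicand φc ρ.1 ρ.2 ^ (1 / 2 - 1 : ℂ) *
      ∑ k, (ρ.2 k + Complex.I * wGrad φc ρ.1 k) * wGrad (fun z => wGrad φc z k) ρ.1 j)
        + Complex.I * wGrad Vc ρ.1 j)

lemma wGrad_const_add (c : ℂ) (f : CSp d → ℂ) (z : CSp d) :
    wGrad (fun z => c + f z) z = wGrad f z := by
  simp [wGrad, fderiv_const_add]

lemma wGrad_const_mul (c : ℂ) {f : CSp d → ℂ} {z : CSp d} (hf : DifferentiableAt ℝ f z)
    (j : Fin d) : wGrad (fun z => c * f z) z j = c * wGrad f z j := by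
  simp [wGrad, fderiv_const_mul hf]
  ring

lemma wGrad_coord_add (k j : Fin d) (c : ℂ) (z : CSp d) :
    wGrad (fun z => z k + c) z j = if j = k then 1 else 0 := by
  have : HasFDerivAt (fun z : CSp d => z k + c)
      ((EuclideanSpace.proj k : CSp d →L[ℂ] ℂ).restrictScalars ℝ) z :=
    (((EuclideanSpace.proj k : CSp d →L[ℂ] ℂ).restrictScalars ℝ).hasFDerivAt).add_const c
  simp only [wGrad, this.fderiv]
  by_cases h : j = k
  · subst h
    simp
    norm_num
  · simp [h, Ne.symm h]

lemma complexHamField_eq {Vc φc : CSp d → ℂ} (hV : AlmostHolomorphic Vc)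
    (hφ : AlmostHolomorphic φc) {ρ : CSp d × CSp d}
    (hρ : symbolRadicand φc ρ.1 ρ.2 ∈ Complex.slitPlane) :
    complexHamField Vc φc ρ = explicitField Vc φc ρ := by
  have hφk : ∀ k, DifferentiableAt ℝ (fun z => wGrad φc z k) ρ.1 := fun k =>
    (hφ.wGrad_apply k).1.differentiable (by simp) _
  refine Prod.ext ?_ ?_
  · ext j
    have h := wGrad_sqrt_symbol (u := fun k ξ => ξ k + Complex.I * wGrad φc ρ.1 k)
      (g := fun _ => Vc ρ.1) (z := ρ.2) (fun k => by fun_prop)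
      (differentiableAt_const _) hρ j
    simp only [wGrad_coord_add] at h
    simp only [complexHamField, explicitField, symbolAPlus, symbolRadicand] at h ⊢
    rw [h]
    simp [wGrad]
  · ext j
    have h := wGrad_sqrt_symbol (u := fun k x => ρ.2 k + Complex.I * wGrad φc x k)
      (g := Vc) (z := ρ.1) (fun k => (hφk k).const_mul _ |>.const_add _)
      (hV.1.differentiable (by simp) _) hρ j
    simp only [wGrad_const_add, wGrad_const_mul _ (hφk _)] at h
    simp only [complexHamField, explicitField, symbolAPlus, symbolRadicand] at h ⊢
    rw [PiLp.neg_apply, h]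
    have : ∀ k, (ρ.2 k + Complex.I * wGrad φc ρ.1 k) *
        (Complex.I * wGrad (fun z => wGrad φc z k) ρ.1 j) =
        Complex.I * ((ρ.2 k + Complex.I * wGrad φc ρ.1 k) *
          wGrad (fun z => wGrad φc z k) ρ.1 j) := fun k => by ring
    simp only [this, ← Finset.mul_sum]
    linear_combination ((1 + ∑ k, (ρ.2 k + Complex.I * wGrad φc ρ.1 k) ^ 2) ^ (1 / 2 - 1 : ℂ) *
      ∑ k, (ρ.2 k + Complex.I * wGrad φc ρ.1 k) *
        wGrad (fun z => wGrad φc z k) ρ.1 j) * Complex.I_sq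

lemma contDiffOn_complexHamField {Vc φc : CSp d → ℂ} (hV : AlmostHolomorphic Vc)
    (hφ : AlmostHolomorphic φc) {Ω : Set (CSp d × CSp d)} (hΩ : IsSymbolDomain φc Ω) :
    ContDiffOn ℝ 1 (complexHamField Vc φc) Ω := by
  refine ContDiffOn.congr (f := explicitField Vc φc) ?_
    fun ρ hρ => complexHamField_eq hV hφ (hΩ.2.2 ρ hρ)
  intro ρ hρ
  refine ContDiffAt.contDiffWithinAt ?_
  have hφ1 : ∀ k, ContDiff ℝ 1 fun ρ : CSp d × CSp d => wGrad φc ρ.1 k := fun k =>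
    ((hφ.wGrad_apply k).1.of_le (by exact_mod_cast le_top)).comp contDiff_fst
  have hφ2 : ∀ k j, ContDiff ℝ 1 fun ρ : CSp d × CSp d => wGrad (fun z => wGrad φc z k) ρ.1 j :=
    fun k j => (((hφ.wGrad_apply k).wGrad_apply j).1.of_le (by exact_mod_cast le_top)).comp
      contDiff_fst
  have hV1 : ∀ k, ContDiff ℝ 1 fun ρ : CSp d × CSp d => wGrad Vc ρ.1 k := fun k =>
    ((hV.wGrad_apply k).1.of_le (by exact_mod_cast le_top)).comp contDiff_fst
  have hc : ∀ k, ContDiff ℝ 1 fun ρ : CSp d × CSp d => ρ.2 k := fun k =>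
    (((EuclideanSpace.proj k : CSp d →L[ℂ] ℂ).restrictScalars ℝ).contDiff).comp contDiff_snd
  have hu : ∀ k, ContDiff ℝ 1 fun ρ : CSp d × CSp d => ρ.2 k + Complex.I * wGrad φc ρ.1 k :=
    fun k => (hc k).add (contDiff_const.mul (hφ1 k))
  have hr : ContDiff ℝ 1 fun ρ : CSp d × CSp d => symbolRadicand φc ρ.1 ρ.2 :=
    contDiff_const.add (ContDiff.sum fun k _ => (hu k).pow 2)
  have hp : ContDiffAt ℝ 1
      (fun ρ : CSp d × CSp d => symbolRadicand φc ρ.1 ρ.2 ^ (1 / 2 - 1 : ℂ)) ρ := by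
    have : ContDiffAt ℂ 1 (fun w : ℂ => w ^ (1 / 2 - 1 : ℂ)) (symbolRadicand φc ρ.1 ρ.2) :=
      (analyticAt_id.cpow analyticAt_const (hΩ.2.2 ρ hρ)).contDiffAt
    exact (this.restrict_scalars ℝ).comp ρ hr.contDiffAt
  refine ContDiffAt.prodMk ?_ ?_
  · refine (contDiffAt_piLp 2).2 fun j => ?_
    exact contDiffAt_const.mul (hp.mul (hu j).contDiffAt)
  · refine (contDiffAt_piLp 2).2 fun j => ?_
    exact (hp.mul (ContDiff.sum fun k _ => (hu k).mul (hφ2 k j)).contDiffAt).neg.add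
      (contDiffAt_const.mul (hV1 j).contDiffAt)

/-- The field is holomorphic in ξ; in x it involves only derivatives of the extensions, which are
complex differentiable at real points. No reality of ξ is needed. -/
lemma differentiableAt_complexHamField {Vc φc : CSp d → ℂ} (hV : AlmostHolomorphic Vc)
    (hφ : AlmostHolomorphic φc) {Ω : Set (CSp d × CSp d)} (hΩ : IsSymbolDomain φc Ω)
    {x : RSp d} {ξ : CSp d} (hx : (realToC x, ξ) ∈ Ω) :
    DifferentiableAt ℂ (complexHamField Vc φc) (realToC x, ξ) := by
  have he : complexHamField Vc φc =ᶠ[𝓝 (realToC x, ξ)] explicitField Vc φc := by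
    filter_upwards [hΩ.1.mem_nhds hx] with ρ hρ
    exact complexHamField_eq hV hφ (hΩ.2.2 ρ hρ)
  refine DifferentiableAt.congr_of_eventuallyEq ?_ he
  have hfst : DifferentiableAt ℂ (fun ρ : CSp d × CSp d => ρ.1) (realToC x, ξ) :=
    differentiableAt_fst
  have hlift : ∀ {f : CSp d → ℂ}, AlmostHolomorphic f →
      DifferentiableAt ℂ (fun ρ : CSp d × CSp d => f ρ.1) (realToC x, ξ) := fun hf =>
    DifferentiableAt.comp (realToC x, ξ) (hf.differentiableAt x) hfst
  have hc : ∀ k, DifferentiableAt ℂ (fun ρ : CSp d × CSp d => ρ.2 k) (realToC x, ξ) := fun k =>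
    (EuclideanSpace.proj k : CSp d →L[ℂ] ℂ).differentiableAt.comp _ differentiableAt_snd
  have hu : ∀ k, DifferentiableAt ℂ
      (fun ρ : CSp d × CSp d => ρ.2 k + Complex.I * wGrad φc ρ.1 k) (realToC x, ξ) :=
    fun k => (hc k).add ((hlift (hφ.wGrad_apply k)).const_mul _)
  have hr : DifferentiableAt ℂ (fun ρ : CSp d × CSp d => symbolRadicand φc ρ.1 ρ.2)
      (realToC x, ξ) :=
    (DifferentiableAt.fun_sum fun k _ => (hu k).pow 2).const_add 1
  have hp : DifferentiableAt ℂ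
      (fun ρ : CSp d × CSp d => symbolRadicand φc ρ.1 ρ.2 ^ (1 / 2 - 1 : ℂ)) (realToC x, ξ) :=
    hr.cpow (differentiableAt_const _) (hΩ.2.2 _ hx)
  refine DifferentiableAt.prodMk ?_ ?_
  · refine (differentiableAt_piLp 2).2 fun j => ?_
    exact (hp.mul (hu j)).const_mul _
  · refine (differentiableAt_piLp 2).2 fun j => ?_
    exact (hp.mul (DifferentiableAt.fun_sum fun k _ => (hu k).mul
      (hlift ((hφ.wGrad_apply k).wGrad_apply j)))).neg.add
      ((hlift (hV.wGrad_apply j)).const_mul _)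

end ComplexField

/-! ### Inverse of the arc length; gradients in coordinates -/

section Calculus

/-- A primitive of a positive continuous function on `[0, T]` has a differentiable inverse. -/
lemma exists_inverse_primitive {T : ℝ} (hT : 0 < T) {l s : ℝ → ℝ}
    (hl : ContinuousOn l (Icc 0 T)) (hpos : ∀ t ∈ Icc 0 T, 0 < l t) (hs0 : s 0 = 0)
    (hs : ∀ t ∈ Icc 0 T, HasDerivWithinAt s (l t) (Icc 0 T) t) :
    0 < s T ∧ ∃ θ : ℝ → ℝ, MapsTo θ (Icc 0 (s T)) (Icc 0 T) ∧ θ 0 = 0 ∧ θ (s T) = T ∧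
      ∀ u ∈ Icc 0 (s T), HasDerivWithinAt θ (l (θ u))⁻¹ (Icc 0 (s T)) u := by
  -- The constant extension of `l` beyond the interval has a primitive on all of ℝ, so the inverse
  -- can be taken globally as an order isomorphism.
  set m : ℝ → ℝ := IccExtend hT.le ((Icc 0 T).domRestrict l) with hm
  have hmc : Continuous m := (continuousOn_iff_continuous_domRestrict.1 hl).Icc_extend'
  have hml : ∀ t ∈ Icc 0 T, m t = l t := fun t ht => by
    rw [hm, IccExtend_of_mem _ _ ht, domRestrict_apply]
  have hmpos : ∀ t, 0 < m t := fun t => hpos _ (projIcc 0 T hT.le t).2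
  obtain ⟨t₀, ht₀, hmin⟩ := isCompact_Icc.exists_isMinOn (nonempty_Icc.2 hT.le) hl
  have hlow : ∀ t, l t₀ ≤ m t := fun t => hmin (projIcc 0 T hT.le t).2
  set S : ℝ → ℝ := fun t => ∫ r in (0 : ℝ)..t, m r with hS
  have hSd : ∀ t, HasDerivAt S (m t) t := fun t => hmc.integral_hasStrictDerivAt 0 t |>.hasDerivAt
  have hSc : Continuous S := continuous_iff_continuousAt.2 fun t => (hSd t).continuousAt
  have hSmono : StrictMono S := strictMono_of_deriv_pos fun t => by rw [(hSd t).deriv]; exact hmpos t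
  have hSs : ∀ t ∈ Icc 0 T, S t = s t := by
    intro t ht
    have := constant_of_has_deriv_right_zero (f := fun t => S t - s t) (a := 0) (b := T)
      (fun t ht => (hSc.continuousAt.continuousWithinAt).sub (hs t ht).continuousWithinAt)
      (fun t ht => by
        have ht' := Ico_subset_Icc_self ht
        refine (((hSd t).hasDerivWithinAt.sub (hs t ht')).congr_deriv ?_).Ici_of_Icc ht
        rw [hml t ht', sub_self]) t ht
    simp only [hs0, hS, intervalIntegral.integral_same, sub_zero] at this
    linarith
  -- The slope is at least the minimum `l t₀ > 0`, which gives the linear growth needed for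
  -- surjectivity.
  have hmono : Monotone fun t => S t - l t₀ * t := monotone_of_deriv_nonneg
    (fun t => ((hSd t).sub ((hasDerivAt_id t).const_mul _)).differentiableAt)
    fun t => by
      have := ((hSd t).fun_sub ((hasDerivAt_id' t).const_mul (l t₀))).deriv
      rw [this]; linarith [hlow t]
  have hS0 : S 0 = 0 := by simp [hS]
  have hl0 := hpos t₀ ht₀
  have hsurj : Function.Surjective S := by
    refine hSc.surjective ?_ ?_
    · refine tendsto_atTop_mono' atTop ?_ (tendsto_id.const_mul_atTop hl0)
      filter_upwards [eventually_ge_atTop 0] with t ht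
      have := hmono ht
      simp only [hS0] at this
      simp only [id]; linarith
    · refine tendsto_atBot_mono' atBot ?_ (tendsto_id.const_mul_atBot hl0)
      filter_upwards [eventually_le_atBot 0] with t ht
      have := hmono ht
      simp only [hS0] at this
      simp only [id]; linarith
  set e := StrictMono.orderIsoOfSurjective S hSmono hsurj
  have he : ∀ u, S (e.symm u) = u := fun u => e.apply_symm_apply u
  have he' : ∀ t, e.symm (S t) = t := fun t => e.symm_apply_apply t
  have hmaps : MapsTo e.symm (Icc 0 (s T)) (Icc 0 T) := by
    intro u hu
    rw [← hSs T (right_mem_Icc.2 hT.le)] at hu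
    exact ⟨hSmono.le_iff_le.1 (by rw [he, hS0]; exact hu.1), hSmono.le_iff_le.1 (by rw [he]; exact hu.2)⟩
  refine ⟨?_, e.symm, hmaps, ?_, ?_, fun u hu => ?_⟩
  · rw [← hSs T (right_mem_Icc.2 hT.le), ← hS0]; exact hSmono hT
  · simpa only [hS0] using he' 0
  · rw [← hSs T (right_mem_Icc.2 hT.le), he']
  · rw [← hml _ (hmaps hu)]
    exact (HasDerivAt.of_local_left_inverse e.symm.continuous.continuousAt (hSd _)
      (hmpos _).ne' (Eventually.of_forall he)).hasDerivWithinAt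

lemma gradient_apply {d : ℕ} (f : RSp d → ℝ) (x : RSp d) (k : Fin d) :
    gradient f x k = fderiv ℝ f x (EuclideanSpace.single k 1) := by
  rw [← inner_gradient_left, EuclideanSpace.inner_single_right]
  simp

lemma contDiff_gradient {d : ℕ} {f : RSp d → ℝ} (hf : ContDiff ℝ ∞ f) :
    ContDiff ℝ ∞ (gradient f) := by
  rw [contDiff_piLp]
  intro k
  simp only [gradient_apply]
  exact (hf.fderiv_right (by exact_mod_cast le_rfl)).clm_apply contDiff_const

lemma hasDerivAt_neg_sqrt {r : ℝ} (hr : 0 < r) :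
    HasDerivAt (fun r => -√r) (-(1 / (2 * √r))) r := (Real.hasDerivAt_sqrt hr.ne').neg

end Calculus

/-! ### Zero energy curves as reparametrized Agmon geodesics -/

section Agmon

variable {d : ℕ} {V : RSp d → ℝ}

lemma gradient_diracHam_momentum (x : RSp d) {p : RSp d} (hp : ‖p‖ < 1) :
    gradient (fun p => diracHam V x p) p = (√(1 - ‖p‖ ^ 2))⁻¹ • p := by
  have h0 : 0 < 1 - ‖p‖ ^ 2 := by nlinarith [norm_nonneg p]
  have h1 : HasFDerivAt (fun p : RSp d => 1 - ‖p‖ ^ 2) (-(2 • innerSL ℝ p)) p :=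
    ((hasStrictFDerivAt_norm_sq p).hasFDerivAt).const_sub 1
  have h2 := ((hasDerivAt_neg_sqrt h0).comp_hasFDerivAt p h1).sub_const (V x)
  refine HasGradientAt.gradient ?_
  rw [hasGradientAt_iff_hasFDerivAt]
  refine h2.congr_fderiv ?_
  ext v
  have : √(1 - ‖p‖ ^ 2) ≠ 0 := (Real.sqrt_pos.2 h0).ne'
  simp
  field_simp

lemma gradient_diracHam_position (hV : Differentiable ℝ V) (x p : RSp d) :
    gradient (fun x => diracHam V x p) x = -gradient V x := by
  refine HasGradientAt.gradient ?_
  rw [hasGradientAt_iff_hasFDerivAt, map_neg]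
  exact (hasGradientAt_iff_hasFDerivAt.1 (hV x).hasGradientAt).const_sub _

lemma agmonInner_eq (x v w : RSp d) : agmonInner V x v w = (1 - V x ^ 2) * ⟪v, w⟫ := by
  simp only [agmonInner, agmonG, Matrix.smul_apply, Matrix.one_apply, smul_eq_mul, mul_ite,
    mul_one, mul_zero, ite_mul, zero_mul, Finset.sum_ite_eq, Finset.mem_univ, if_true,
    PiLp.inner_apply, Finset.mul_sum]
  refine Finset.sum_congr rfl fun i _ => ?_
  simp
  ring

lemma agmonLength_eq_integral {q v : ℝ → RSp d} {f : ℝ → ℝ} {b : ℝ} (hb : 0 ≤ b)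
    (hq : ∀ t ∈ Icc 0 b, HasDerivWithinAt q (v t) (Icc 0 b) t)
    (hf : ∀ t ∈ Icc 0 b, 0 ≤ f t ∧ (1 - V (q t) ^ 2) * ‖v t‖ ^ 2 = f t ^ 2) :
    agmonLength V q 0 b = ∫ t in (0 : ℝ)..b, f t := by
  rw [agmonLength]
  -- `agmonLength` uses the two-sided `deriv`, whose value at the end points is not controlled;
  -- these do not affect the integral.
  refine intervalIntegral.integral_congr_Ioo_of_le hb fun t ht => ?_
  have ht' := Ioo_subset_Icc_self ht
  have hd : deriv q t = v t := ((hq t ht').hasDerivAt (Icc_mem_nhds ht.1 ht.2)).deriv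
  simp only [hd]
  rw [agmonInner_eq, real_inner_self_eq_norm_sq, (hf t ht').2, Real.sqrt_sq (hf t ht').1]

/-- A curve solving the Hamiltonian equations of the Dirac Hamiltonian on the zero energy
shell, where `√(1 - |P|²) = -V(X)`. -/
def IsShellCurve (V : RSp d → ℝ) (T : ℝ) (X P : ℝ → RSp d) : Prop :=
  ∀ t ∈ Icc 0 T, ‖P t‖ ^ 2 = 1 - V (X t) ^ 2 ∧
    HasDerivWithinAt X ((-V (X t))⁻¹ • P t) (Icc 0 T) t ∧
    HasDerivWithinAt P (gradient V (X t)) (Icc 0 T) t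

lemma diracHam_eq_zero_iff {x p : RSp d} (hV : V x < 0) (hp : ‖p‖ < 1) :
    diracHam V x p = 0 ↔ ‖p‖ ^ 2 = 1 - V x ^ 2 := by
  have h0 : 0 < 1 - ‖p‖ ^ 2 := by nlinarith [norm_nonneg p]
  have h1 := Real.sq_sqrt h0.le
  have h2 := Real.sqrt_nonneg (1 - ‖p‖ ^ 2)
  rw [diracHam]
  constructor
  · intro h
    have : √(1 - ‖p‖ ^ 2) = -V x := by linarith
    rw [this] at h1; linarith
  · intro h
    have : 1 - ‖p‖ ^ 2 = (-V x) ^ 2 := by rw [h]; ring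
    rw [this, Real.sqrt_sq (by linarith)]; ring

lemma sqrt_eq_of_shell {x p : RSp d} (hV : V x < 0) (h : ‖p‖ ^ 2 = 1 - V x ^ 2) :
    √(1 - ‖p‖ ^ 2) = -V x := by
  have : 1 - ‖p‖ ^ 2 = (-V x) ^ 2 := by rw [h]; ring
  rw [this, Real.sqrt_sq (by linarith)]

lemma IsZeroEnergyTrajectory.isShellCurve (hV : Differentiable ℝ V) (hV0 : ∀ x, V x < 0) {τ : ℝ}
    {γ ϖ : ℝ → RSp d} (h : IsZeroEnergyTrajectory V τ γ ϖ) : IsShellCurve V τ γ ϖ := by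
  intro t ht
  obtain ⟨h1, h2, h3, h4⟩ := h t ht
  have hs := (diracHam_eq_zero_iff (hV0 _) h1).1 h4
  rw [gradient_diracHam_momentum _ h1, sqrt_eq_of_shell (hV0 _) hs] at h2
  rw [gradient_diracHam_position hV, neg_neg] at h3
  exact ⟨hs, h2, h3⟩

/-- H is conserved: the two terms of its derivative along the curve cancel. Thus only the initial
momentum has to lie on the shell, which is what varying `p` on a sphere provides. -/
lemma isShellCurve_of_energy (hV : Differentiable ℝ V) (hV0 : ∀ x, V x < 0) {T : ℝ}
    {X P : ℝ → RSp d}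
    (hX : ∀ t ∈ Icc 0 T, HasDerivWithinAt X ((√(1 - ‖P t‖ ^ 2))⁻¹ • P t) (Icc 0 T) t)
    (hP : ∀ t ∈ Icc 0 T, HasDerivWithinAt P (gradient V (X t)) (Icc 0 T) t)
    (h1 : ∀ t ∈ Icc 0 T, ‖P t‖ < 1) (h0 : diracHam V (X 0) (P 0) = 0) : IsShellCurve V T X P := by
  have hd : ∀ t ∈ Icc 0 T, HasDerivWithinAt (fun t => diracHam V (X t) (P t)) 0 (Icc 0 T) t := by
    intro t ht
    have h0 : 0 < 1 - ‖P t‖ ^ 2 := by nlinarith [norm_nonneg (P t), h1 t ht]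
    have hv := (hV (X t)).hasFDerivAt.comp_hasDerivWithinAt t (hX t ht)
    have hn := ((hP t ht).norm_sq).const_sub 1
    have hq := (hasDerivAt_neg_sqrt h0).comp_hasDerivWithinAt t hn
    refine (hq.sub hv).congr_deriv ?_
    rw [← inner_gradient_left, real_inner_smul_right, real_inner_comm (P t)]
    have : √(1 - ‖P t‖ ^ 2) ≠ 0 := (Real.sqrt_pos.2 h0).ne'
    field_simp
    ring
  intro t ht
  have he := constant_of_has_deriv_right_zero (fun t ht => (hd t ht).continuousWithinAt)
    (fun t ht => (hd t (Ico_subset_Icc_self ht)).Ici_of_Icc ht) t ht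
  have hs := (diracHam_eq_zero_iff (hV0 _) (h1 t ht)).1 (he.trans h0)
  exact ⟨hs, by simpa only [sqrt_eq_of_shell (hV0 _) hs] using hX t ht, hP t ht⟩

lemma agmonGDeriv_eq (hV : Differentiable ℝ V) (x : RSp d) (l i j : Fin d) :
    agmonGDeriv V x l i j = if i = j then -2 * V x * gradient V x l else 0 := by
  rw [gradient_apply, agmonGDeriv]
  have : (fun z => agmonG V z i j) = fun z => (if i = j then (1 : ℝ) else 0) * (1 - V z ^ 2) := by
    ext z; simp [agmonG, Matrix.one_apply]
  rw [this]
  have h := (((hV x).hasFDerivAt.pow 2).const_sub 1).const_mul (if i = j then (1 : ℝ) else 0)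
  rw [h.fderiv]
  split_ifs <;> simp

/-- The geodesic field of the conformal metric `(1 - V²) 𝟙` in closed form. -/
lemma geodesicField_eq (hV : Differentiable ℝ V) (hg : ∀ x, 0 < 1 - V x ^ 2)
    (ρ : RSp d × RSp d) : geodesicField V ρ =
      (ρ.2, (2 * V ρ.1 * ⟪gradient V ρ.1, ρ.2⟫ / (1 - V ρ.1 ^ 2)) • ρ.2 -
        (V ρ.1 * ‖ρ.2‖ ^ 2 / (1 - V ρ.1 ^ 2)) • gradient V ρ.1) := by
  obtain ⟨x, w⟩ := ρ
  refine Prod.ext rfl ?_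
  ext k
  have hg' := (hg x).ne'
  have hinv : (agmonG V x)⁻¹ = (1 - V x ^ 2)⁻¹ • (1 : Matrix (Fin d) (Fin d) ℝ) := by
    refine Matrix.inv_eq_left_inv ?_
    rw [agmonG, smul_mul_smul_comm, inv_mul_cancel₀ hg', one_smul, one_mul]
  have hΓ : ∀ i j, agmonChristoffel V x k i j = -(V x / (1 - V x ^ 2)) *
      ((if k = j then gradient V x i else 0) + (if k = i then gradient V x j else 0) -
        (if i = j then gradient V x k else 0)) := by
    intro i j
    rw [agmonChristoffel, hinv, Finset.sum_eq_single k]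
    · simp only [agmonGDeriv_eq hV, Matrix.smul_apply, Matrix.one_apply_eq, smul_eq_mul, mul_one]
      field_simp
      split_ifs <;> ring
    · intro l _ hl; simp [hl.symm]
    · simp
  simp only [geodesicField, hΓ, PiLp.sub_apply, PiLp.smul_apply, smul_eq_mul]
  rw [← real_inner_self_eq_norm_sq]
  have e1 : ∀ i j, -(V x / (1 - V x ^ 2)) *
      ((if k = j then gradient V x i else 0) + (if k = i then gradient V x j else 0) -
        (if i = j then gradient V x k else 0)) * w i * w j =
      -(V x / (1 - V x ^ 2)) * ((if k = j then gradient V x i * w i * w j else 0) +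
        (if k = i then w i * (gradient V x j * w j) else 0) -
        (if i = j then gradient V x k * (w i * w j) else 0)) := by
    intro i j; split_ifs <;> ring
  simp only [e1, ← Finset.mul_sum, Finset.sum_add_distrib, Finset.sum_sub_distrib,
    Finset.sum_ite_eq, Finset.mem_univ, if_true, ← Finset.sum_mul, PiLp.inner_apply,
    Real.inner_apply]
  have e2 : ∑ i, ∑ j, (if k = i then w i * (gradient V x j * w j) else 0) =
      w k * ∑ j, gradient V x j * w j := by
    rw [Finset.sum_eq_single k]
    · simp [Finset.mul_sum]
    · intro i _ hi; simp [hi.symm]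
    · simp
  rw [e2]
  ring

lemma contDiff_geodesicField (hV : ContDiff ℝ ∞ V) (hg : ∀ x, 0 < 1 - V x ^ 2) :
    ContDiff ℝ 1 (geodesicField V) := by
  rw [funext (geodesicField_eq (hV.differentiable (by simp)) hg)]
  have hV1 : ContDiff ℝ 1 fun ρ : RSp d × RSp d => V ρ.1 :=
    (hV.of_le (by exact_mod_cast le_top)).comp contDiff_fst
  have hG : ContDiff ℝ 1 fun ρ : RSp d × RSp d => gradient V ρ.1 :=
    ((contDiff_gradient hV).of_le (by exact_mod_cast le_top)).comp contDiff_fst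
  have hne : ∀ ρ : RSp d × RSp d, 1 - V ρ.1 ^ 2 ≠ 0 := fun ρ => (hg _).ne'
  refine contDiff_snd.prodMk (ContDiff.sub (ContDiff.fun_smul ?_ contDiff_snd)
    (ContDiff.fun_smul ?_ hG))
  · exact ((contDiff_const.mul hV1).mul (hG.inner ℝ contDiff_snd)).div
      (contDiff_const.sub (hV1.pow 2)) hne
  · exact (hV1.mul (contDiff_snd.norm_sq ℝ)).div (contDiff_const.sub (hV1.pow 2)) hne

/-- A shell curve, reparametrized affinely by its Agmon length, is a geodesic. -/
lemma IsShellCurve.exists_geodesic (hV : ContDiff ℝ ∞ V) (hV0 : ∀ x, V x < 0)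
    (hg : ∀ x, 0 < 1 - V x ^ 2) {T : ℝ} (hT : 0 < T) {X P : ℝ → RSp d} (h : IsShellCurve V T X P)
    {s : ℝ → ℝ} (hs0 : s 0 = 0)
    (hs : ∀ t ∈ Icc 0 T, HasDerivWithinAt s ((1 - V (X t) ^ 2) / (-V (X t))) (Icc 0 T) t) :
    0 < s T ∧ ∃ q w : ℝ → RSp d,
      IsIntegralCurveFrom (geodesicField V) univ 1
        (X 0, (s T / (1 - V (X 0) ^ 2)) • P 0) (fun r => (q r, w r)) ∧
      q 1 = X T ∧ ∀ u ∈ Icc (0 : ℝ) 1, (1 - V (q u) ^ 2) * ‖w u‖ ^ 2 = s T ^ 2 := by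
  have hVd := hV.differentiable (by simp)
  have hXc : ContinuousOn X (Icc 0 T) := fun t ht => (h t ht).2.1.continuousWithinAt
  have hVX : ContinuousOn (fun t => V (X t)) (Icc 0 T) := hV.continuous.comp_continuousOn hXc
  obtain ⟨hpos, θ, hmaps, hθ0, hθT, hθ⟩ := exists_inverse_primitive hT
    (l := fun t => (1 - V (X t) ^ 2) / (-V (X t))) ((continuousOn_const.sub (hVX.pow 2)).div hVX.neg fun t _ => by
      exact neg_ne_zero.2 (hV0 (X t)).ne)
    (fun t _ => div_pos (hg _) (by linarith [hV0 (X t)])) hs0 hs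
  set D := s T
  have hmul : MapsTo (fun u : ℝ => D * u) (Icc 0 1) (Icc 0 D) := fun u hu =>
    ⟨mul_nonneg hpos.le hu.1, mul_le_of_le_one_right hpos.le hu.2⟩
  have hϑ : ∀ u ∈ Icc (0 : ℝ) 1, HasDerivWithinAt (fun u => θ (D * u))
      (((1 - V (X (θ (D * u))) ^ 2) / (-V (X (θ (D * u)))))⁻¹ * D) (Icc 0 1) u := fun u hu =>
    HasDerivWithinAt.comp u (hθ _ (hmul hu))
      (by simpa using (hasDerivAt_id u).const_mul D |>.hasDerivWithinAt) hmul
  have hmaps' : MapsTo (fun u => θ (D * u)) (Icc 0 1) (Icc 0 T) := hmaps.comp hmul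
  -- With `θ` the inverse of the arc length, dq/du = D · (dt/ds) · P/(−V) = (D/g) P, where g = 1 −
  -- V². This is the velocity `w`.
  refine ⟨hpos, fun u => X (θ (D * u)),
    fun u => (D / (1 - V (X (θ (D * u))) ^ 2)) • P (θ (D * u)), ?_, by simp [hθT], ?_⟩
  · rw [isIntegralCurveFrom_iff zero_le_one]
    refine ⟨by simp [hθ0], fun u hu => ⟨mem_univ _, ?_⟩⟩
    obtain ⟨hsh, hX, hP⟩ := h _ (hmaps' hu)
    rw [geodesicField_eq hVd hg]
    have hX' := hX.scomp u (hϑ u hu) hmaps'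
    have hP' := hP.scomp u (hϑ u hu) hmaps'
    have hV' := (hVd _).hasFDerivAt.comp_hasDerivWithinAt u hX'
    have hv0 := (hV0 (X (θ (D * u)))).ne
    have hg0 := (hg (X (θ (D * u)))).ne'
    refine HasDerivWithinAt.prodMk ?_ ?_
    · refine hX'.congr_deriv ?_
      rw [smul_smul]
      congr 1
      field_simp
    · have hc := (hasDerivWithinAt_const u (Icc 0 1) D).fun_div ((hV'.fun_pow 2).const_sub 1) hg0
      refine (hc.fun_smul hP').congr_deriv ?_
      simp only [Function.comp_apply, ← inner_gradient_left, real_inner_smul_right, norm_smul,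
        mul_pow, hsh, smul_smul, Real.norm_eq_abs, sq_abs]
      rw [sub_eq_add_neg (_ • P _), ← neg_smul, add_comm]
      congr 1
      · congr 1
        field_simp
        ring
      · congr 1
        field_simp
  · intro u hu
    obtain ⟨hsh, -⟩ := h _ (hmaps' hu)
    have hg0 := (hg (X (θ (D * u)))).ne'
    simp only [norm_smul, mul_pow, Real.norm_eq_abs, sq_abs, hsh]
    field_simp

lemma IsShellCurve.agmonExp_eq (hV : ContDiff ℝ ∞ V) (hV0 : ∀ x, V x < 0)
    (hg : ∀ x, 0 < 1 - V x ^ 2) {T : ℝ} (hT : 0 < T) {X P : ℝ → RSp d} (h : IsShellCurve V T X P)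
    {s : ℝ → ℝ} (hs0 : s 0 = 0)
    (hs : ∀ t ∈ Icc 0 T, HasDerivWithinAt s ((1 - V (X t) ^ 2) / (-V (X t))) (Icc 0 T) t) :
    agmonExp V (X 0) ((s T / (1 - V (X 0) ^ 2)) • P 0) = X T := by
  obtain ⟨-, q, w, hq, hq1, -⟩ := h.exists_geodesic hV hV0 hg hT hs0 hs
  rw [agmonExp, hq.flowAt_eq isOpen_univ (contDiff_geodesicField hV hg).contDiffOn zero_le_one]
  exact hq1

end Agmon

/-! ### Comparing the real flow, the complex flow and the exponential map -/

section Comparison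

variable {d : ℕ} {V φ : RSp d → ℝ} {Vc φc : CSp d → ℂ}

/-- The Hamiltonian field of the Dirac Hamiltonian, together with the Agmon arc length of the
projected zero energy curves. -/
noncomputable def shellField (V : RSp d → ℝ) (ρ : RSp d × RSp d × ℝ) : RSp d × RSp d × ℝ :=
  ((√(1 - ‖ρ.2.1‖ ^ 2))⁻¹ • ρ.2.1, gradient V ρ.1, (1 - V ρ.1 ^ 2) / (-V ρ.1))

lemma contDiffOn_shellField (hV : ContDiff ℝ ∞ V) (hV0 : ∀ x, V x < 0)
    {Ω : Set (RSp d × RSp d × ℝ)} (hΩ : ∀ ρ ∈ Ω, ‖ρ.2.1‖ < 1) :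
    ContDiffOn ℝ 1 (shellField V) Ω := by
  intro ρ hρ
  refine ContDiffAt.contDiffWithinAt ?_
  have h0 : 1 - ‖ρ.2.1‖ ^ 2 ≠ 0 := by nlinarith [norm_nonneg ρ.2.1, hΩ ρ hρ]
  have hs : 0 < 1 - ‖ρ.2.1‖ ^ 2 := by nlinarith [norm_nonneg ρ.2.1, hΩ ρ hρ]
  have hp : ContDiff ℝ 1 fun ρ : RSp d × RSp d × ℝ => ρ.2.1 := contDiff_fst.comp contDiff_snd
  have hV1 : ContDiff ℝ 1 fun ρ : RSp d × RSp d × ℝ => V ρ.1 :=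
    (hV.of_le (by exact_mod_cast le_top)).comp contDiff_fst
  refine ContDiffAt.prodMk ?_ (ContDiffAt.prodMk ?_ ?_)
  · exact (((contDiff_const.sub (hp.norm_sq ℝ)).contDiffAt.sqrt h0).inv
      (Real.sqrt_pos.2 hs).ne').smul hp.contDiffAt
  · exact (((contDiff_gradient hV).of_le (by exact_mod_cast le_top)).comp contDiff_fst).contDiffAt
  · exact (contDiff_const.sub (hV1.pow 2)).contDiffAt.div hV1.neg.contDiffAt
      (neg_ne_zero.2 (hV0 _).ne)

/-- The embedding `(x, p) ↦ (x, i(p - ∇φ(x)))` of the real phase space into `ℂ^{2d}`. -/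
noncomputable def phaseEmbedding (φ : RSp d → ℝ) (x p : RSp d) : CSp d × CSp d :=
  (realToC x, Complex.I • realToC (p - gradient φ x))

lemma hasDerivWithinAt_phaseEmbedding (hφ : ContDiff ℝ ∞ φ) {X P : ℝ → RSp d} {X' P' : RSp d}
    {s : Set ℝ} {t : ℝ} (hX : HasDerivWithinAt X X' s t) (hP : HasDerivWithinAt P P' s t) :
    HasDerivWithinAt (fun t => phaseEmbedding φ (X t) (P t))
      (realToC X', Complex.I • realToC (P' - fderiv ℝ (gradient φ) (X t) X')) s t := by
  have hG := (((contDiff_gradient hφ).differentiable (by simp)) (X t)).hasFDerivAt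
  refine HasDerivWithinAt.prodMk ((realToCL d).hasFDerivAt.comp_hasDerivWithinAt t hX) ?_
  exact ((realToCL d).hasFDerivAt.comp_hasDerivWithinAt t
    (hP.sub (hG.comp_hasDerivWithinAt t hX))).const_smul Complex.I

lemma fderiv_gradient_apply (hφ : ContDiff ℝ ∞ φ) (x v : RSp d) (k : Fin d) :
    fderiv ℝ (fun x => gradient φ x k) x v = fderiv ℝ (gradient φ) x v k := by
  have hG := (((contDiff_gradient hφ).differentiable (by simp)) x).hasFDerivAt
  have := ((EuclideanSpace.proj k : RSp d →L[ℝ] ℝ).hasFDerivAt.comp x hG).fderiv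
  exact congrArg (fun L => L v) this

/-- The field of a_+ contracts the Hessian of φ in one index, the derivative of ∇φ along a curve in
the other. -/
lemma fderiv_gradient_symm (hφ : ContDiff ℝ ∞ φ) (x : RSp d) (j k : Fin d) :
    fderiv ℝ (gradient φ) x (EuclideanSpace.single j 1) k =
      fderiv ℝ (gradient φ) x (EuclideanSpace.single k 1) j := by
  have hd : DifferentiableAt ℝ (fderiv ℝ φ) x :=
    (hφ.fderiv_right (m := ∞) (by exact_mod_cast le_rfl)).differentiable (by simp) x
  have h : ∀ u v : RSp d, fderiv ℝ (fun z => fderiv ℝ φ z u) x v =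
      fderiv ℝ (fderiv ℝ φ) x v u := by
    intro u v
    rw [fderiv_clm_apply hd (differentiableAt_const u)]
    simp
  rw [← fderiv_gradient_apply hφ, ← fderiv_gradient_apply hφ]
  simp only [gradient_apply, h]
  exact (hφ.contDiffAt.isSymmSndFDerivAt (by simpa using ENat.LEInfty.out)).eq _ _

/-- On the image of the embedding ξ + i∇φ = ip, hence the radicand is 1 − |p|². The result is
exactly the velocity that `hasDerivWithinAt_phaseEmbedding` assigns to a trajectory of H. -/
lemma explicitField_phaseEmbedding (hV : ContDiff ℝ ∞ V) (hφ : ContDiff ℝ ∞ φ)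
    (hVc : IsAlmostAnalyticExtension V Vc) (hφc : IsAlmostAnalyticExtension φ φc)
    (x : RSp d) {p : RSp d} (hp : ‖p‖ < 1) :
    explicitField Vc φc (phaseEmbedding φ x p) =
      (realToC ((√(1 - ‖p‖ ^ 2))⁻¹ • p), Complex.I • realToC (gradient V x -
        fderiv ℝ (gradient φ) x ((√(1 - ‖p‖ ^ 2))⁻¹ • p))) := by
  have h0 : 0 < 1 - ‖p‖ ^ 2 := by nlinarith [norm_nonneg p]
  have hφ1 : ∀ k z, wGrad φc (realToC z) k = (gradient φ z k : ℂ) := fun k z => by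
    rw [hφc.almostHolomorphic.wGrad_realToC hφc.2.1 (hφ.differentiable (by simp)), gradient_apply]
  have hV1 : ∀ k, wGrad Vc (realToC x) k = (gradient V x k : ℂ) := fun k => by
    rw [hVc.almostHolomorphic.wGrad_realToC hVc.2.1 (hV.differentiable (by simp)), gradient_apply]
  have hφ2 : ∀ k j, wGrad (fun z => wGrad φc z k) (realToC x) j =
      (fderiv ℝ (gradient φ) x (EuclideanSpace.single k 1) j : ℂ) := fun k j => by
    have hd : Differentiable ℝ fun x => gradient φ x k := fun z =>
      (EuclideanSpace.proj k : RSp d →L[ℝ] ℝ).differentiableAt.comp z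
        ((contDiff_gradient hφ).differentiable (by simp) z)
    rw [(hφc.almostHolomorphic.wGrad_apply k).wGrad_realToC (hφ1 k) hd,
      fderiv_gradient_apply hφ, fderiv_gradient_symm hφ]
  have hu : ∀ k, (Complex.I • realToC (p - gradient φ x)) k + Complex.I * wGrad φc (realToC x) k =
      Complex.I * (p k : ℂ) := fun k => by
    rw [hφ1]; simp; ring
  have hr : symbolRadicand φc (realToC x) (Complex.I • realToC (p - gradient φ x)) =
      ((1 - ‖p‖ ^ 2 : ℝ) : ℂ) := by
    simp only [symbolRadicand, hu, mul_pow, Complex.I_sq, EuclideanSpace.real_norm_sq_eq]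
    push_cast
    simp [sub_eq_add_neg]
  have hpow : ((1 - ‖p‖ ^ 2 : ℝ) : ℂ) ^ (1 / 2 - 1 : ℂ) = (((√(1 - ‖p‖ ^ 2))⁻¹ : ℝ) : ℂ) := by
    rw [Real.sqrt_eq_rpow, ← Real.rpow_neg h0.le, Complex.ofReal_cpow h0.le]
    congr 1
    push_cast; ring
  simp only [phaseEmbedding, explicitField, hr, hu, hV1, hφ2, hpow]
  generalize (√(1 - ‖p‖ ^ 2))⁻¹ = c
  refine Prod.ext ?_ ?_
  · ext j
    simp only [realToC_apply, PiLp.smul_apply, smul_eq_mul, Complex.ofReal_mul]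
    linear_combination (-(c : ℂ) * p j) * Complex.I_sq
  · ext j
    have hsum : fderiv ℝ (gradient φ) x p j =
        ∑ k, p k * fderiv ℝ (gradient φ) x (EuclideanSpace.single k 1) j := by
      conv_lhs => rw [← (EuclideanSpace.basisFun (Fin d) ℝ).sum_repr p]
      simp
    simp only [map_smul, PiLp.smul_apply, realToC_apply, PiLp.sub_apply, smul_eq_mul, hsum,
      Complex.ofReal_sub, Complex.ofReal_mul, Complex.ofReal_sum, mul_assoc, ← Finset.mul_sum]
    ring

lemma isIntegralCurveFrom_phaseEmbedding (hV : ContDiff ℝ ∞ V) (hφ : ContDiff ℝ ∞ φ)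
    (hVc : IsAlmostAnalyticExtension V Vc) (hφc : IsAlmostAnalyticExtension φ φc)
    {Ω : Set (CSp d × CSp d)} (hΩ : IsSymbolDomain φc Ω) {T : ℝ} (hT : 0 ≤ T) {X P : ℝ → RSp d}
    (hX : ∀ t ∈ Icc 0 T, HasDerivWithinAt X ((√(1 - ‖P t‖ ^ 2))⁻¹ • P t) (Icc 0 T) t)
    (hP : ∀ t ∈ Icc 0 T, HasDerivWithinAt P (gradient V (X t)) (Icc 0 T) t)
    (h1 : ∀ t ∈ Icc 0 T, ‖P t‖ < 1) (hm : ∀ t ∈ Icc 0 T, phaseEmbedding φ (X t) (P t) ∈ Ω) :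
    IsIntegralCurveFrom (complexHamField Vc φc) Ω T (phaseEmbedding φ (X 0) (P 0))
      (fun t => phaseEmbedding φ (X t) (P t)) := by
  rw [isIntegralCurveFrom_iff hT]
  refine ⟨rfl, fun t ht => ⟨hm t ht, ?_⟩⟩
  rw [complexHamField_eq hVc.almostHolomorphic hφc.almostHolomorphic (hΩ.2.2 _ (hm t ht)),
    explicitField_phaseEmbedding hV hφ hVc hφc _ (h1 t ht)]
  exact hasDerivWithinAt_phaseEmbedding hφ (hX t ht) (hP t ht)

/-- Along a minimizing zero energy curve the momentum is the gradient of the weight. -/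
lemma IsShellCurve.gradient_eq (hV : ContDiff ℝ ∞ V) (hV0 : ∀ x, V x < 0) (hφ : ContDiff ℝ ∞ φ)
    (h1 : ∀ x, ‖gradient φ x‖ < 1) (hle : ∀ x, diracHam V x (gradient φ x) ≤ 0) {T : ℝ}
    (hT : 0 < T) {X P : ℝ → RSp d} (h : IsShellCurve V T X P) {s : ℝ → ℝ} (hs0 : s 0 = 0)
    (hs : ∀ t ∈ Icc 0 T, HasDerivWithinAt s ((1 - V (X t) ^ 2) / (-V (X t))) (Icc 0 T) t)
    (heq : φ (X T) - φ (X 0) = s T) : ∀ t ∈ Icc 0 T, gradient φ (X t) = P t := by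
  have hgr : ∀ x, ‖gradient φ x‖ ^ 2 ≤ 1 - V x ^ 2 := by
    intro x
    have h0 : 0 ≤ 1 - ‖gradient φ x‖ ^ 2 := by nlinarith [norm_nonneg (gradient φ x), h1 x]
    have h2 := hle x
    rw [diracHam] at h2
    nlinarith [Real.sq_sqrt h0, Real.sqrt_nonneg (1 - ‖gradient φ x‖ ^ 2), hV0 x]
  -- Both claims come from 0 ≤ |∇φ − P|² ≤ 2(1 − V² − ⟨∇φ, P⟩).
  have hcs : ∀ t ∈ Icc 0 T, ⟪gradient φ (X t), P t⟫ ≤ 1 - V (X t) ^ 2 ∧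
      (⟪gradient φ (X t), P t⟫ = 1 - V (X t) ^ 2 → gradient φ (X t) = P t) := by
    intro t ht
    have hn := norm_sub_sq_real (gradient φ (X t)) (P t)
    have hp := (h t ht).1
    have hg := hgr (X t)
    refine ⟨by nlinarith [sq_nonneg ‖gradient φ (X t) - P t‖], fun he => ?_⟩
    rw [← sub_eq_zero, ← norm_eq_zero, ← sq_eq_zero_iff]
    exact le_antisymm (by linarith) (sq_nonneg _)
  have hXc : ContinuousOn X (Icc 0 T) := fun t ht => (h t ht).2.1.continuousWithinAt
  have hPc : ContinuousOn P (Icc 0 T) := fun t ht => (h t ht).2.2.continuousWithinAt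
  have hVX : ContinuousOn (fun t => V (X t)) (Icc 0 T) := hV.continuous.comp_continuousOn hXc
  -- `e` is the derivative of s − φ(X). It is nonnegative while s − φ(X) agrees at both ends, so
  -- that function is constant and `e` vanishes.
  set e : ℝ → ℝ := fun t => (-V (X t))⁻¹ * (1 - V (X t) ^ 2 - ⟪gradient φ (X t), P t⟫)
  have hVinv : ∀ t, 0 < (-V (X t))⁻¹ := fun t => inv_pos.2 (neg_pos.2 (hV0 _))
  have hec : ContinuousOn e (Icc 0 T) :=
    (hVX.neg.inv₀ fun t _ => neg_ne_zero.2 (hV0 (X t)).ne).mul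
      ((continuousOn_const.sub (hVX.pow 2)).sub
        (((contDiff_gradient hφ).continuous.comp_continuousOn hXc).inner hPc))
  have hd : ∀ t ∈ Icc 0 T, HasDerivWithinAt (fun t => s t - φ (X t)) (e t) (Icc 0 T) t := by
    intro t ht
    have hf := (hφ.differentiable (by simp) (X t)).hasFDerivAt.comp_hasDerivWithinAt t (h t ht).2.1
    refine ((hs t ht).sub hf).congr_deriv ?_
    rw [← inner_gradient_left, real_inner_smul_right]
    simp only [e]
    ring
  have hnonneg : ∀ t ∈ Icc 0 T, 0 ≤ e t := fun t ht =>
    mul_nonneg (hVinv t).le (sub_nonneg.2 (hcs t ht).1)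
  have hmono : MonotoneOn (fun t => s t - φ (X t)) (Icc 0 T) :=
    monotoneOn_of_hasDerivWithinAt_nonneg (convex_Icc 0 T)
      (fun t ht => (hd t ht).continuousWithinAt)
      (fun t ht => (hd t (interior_subset ht)).mono interior_subset)
      fun t ht => hnonneg t (interior_subset ht)
  have hends : s T - φ (X T) = s 0 - φ (X 0) := by rw [hs0]; linarith
  have hconst : ∀ t ∈ Icc 0 T, s t - φ (X t) = s 0 - φ (X 0) := fun t ht =>
    le_antisymm ((hmono ht (right_mem_Icc.2 hT.le) ht.2).trans hends.le)
      (hmono (left_mem_Icc.2 hT.le) ht ht.1)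
  intro t ht
  refine (hcs t ht).2 ?_
  have he0 : e t = 0 :=
    ((uniqueDiffOn_Icc hT) t ht).eq_deriv _ (hd t ht)
      ((hasDerivWithinAt_const t (Icc 0 T) (s 0 - φ (X 0))).congr hconst (hconst t ht))
  have := (mul_eq_zero.1 he0).resolve_left (hVinv t).ne'
  linarith

/-- On the shell |P|² = 1 − V², so the Agmon speed √(1 − V²)|P|/(−V) equals (1 − V²)/(−V). -/
lemma IsShellCurve.agmonLength_eq (hV0 : ∀ x, V x < 0) (hg : ∀ x, 0 < 1 - V x ^ 2)
    (hVc : Continuous V) {T : ℝ} (hT : 0 < T)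
    {X P : ℝ → RSp d} (h : IsShellCurve V T X P) {s : ℝ → ℝ} (hs0 : s 0 = 0)
    (hs : ∀ t ∈ Icc 0 T, HasDerivWithinAt s ((1 - V (X t) ^ 2) / (-V (X t))) (Icc 0 T) t) :
    agmonLength V X 0 T = s T := by
  have hXc : ContinuousOn X (Icc 0 T) := fun t ht => (h t ht).2.1.continuousWithinAt
  have hVX : ContinuousOn (fun t => V (X t)) (Icc 0 T) := hVc.comp_continuousOn hXc
  rw [agmonLength_eq_integral hT.le (fun t ht => (h t ht).2.1)
    (f := fun t => (1 - V (X t) ^ 2) / (-V (X t))) fun t ht => ⟨?_, ?_⟩]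
  · rw [intervalIntegral.integral_eq_sub_of_hasDeriv_right_of_le (f := s) hT.le
      (fun t ht => (hs t ht).continuousWithinAt)
      (fun t ht => ((hs t (Ioo_subset_Icc_self ht)).Ici_of_Icc ⟨ht.1.le, ht.2⟩).mono
        Ioi_subset_Ici_self), hs0, sub_zero]
    refine ContinuousOn.intervalIntegrable_of_Icc hT.le ?_
    exact (continuousOn_const.sub (hVX.pow 2)).div hVX.neg fun t _ => neg_ne_zero.2 (hV0 (X t)).ne
  · exact div_nonneg (hg _).le (neg_nonneg.2 (hV0 _).le)
  · have := (hV0 (X t)).ne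
    rw [norm_smul, mul_pow, (h t ht).1, Real.norm_eq_abs, sq_abs]
    field_simp

lemma exists_shell_length (hV : Continuous V) (hV0 : ∀ x, V x < 0) {T : ℝ} (hT : 0 ≤ T)
    {X : ℝ → RSp d} (hX : ContinuousOn X (Icc 0 T)) :
    ∃ s : ℝ → ℝ, s 0 = 0 ∧
      ∀ t ∈ Icc 0 T, HasDerivWithinAt s ((1 - V (X t) ^ 2) / (-V (X t))) (Icc 0 T) t := by
  have hVX : ContinuousOn (fun t => V (X t)) (Icc 0 T) := hV.comp_continuousOn hX
  have hl : ContinuousOn (fun t => (1 - V (X t) ^ 2) / (-V (X t))) (Icc 0 T) :=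
    (continuousOn_const.sub (hVX.pow 2)).div hVX.neg fun t _ => neg_ne_zero.2 (hV0 (X t)).ne
  have hm := (continuousOn_iff_continuous_domRestrict.1 hl).Icc_extend' (h := hT)
  refine ⟨fun t => ∫ r in (0 : ℝ)..t, _, by simp, fun t ht =>
    ((hm.integral_hasStrictDerivAt 0 t).hasDerivAt.hasDerivWithinAt).congr_deriv ?_⟩
  rw [IccExtend_of_mem _ _ ht, domRestrict_apply]

/-- If a minimizing shell curve starts at `y`, the inverse exponential map is given by its
initial momentum. -/
lemma IsShellCurve.agmonLog_eq (hV : ContDiff ℝ ∞ V) (hV0 : ∀ x, V x < 0)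
    (hg : ∀ x, 0 < 1 - V x ^ 2) {T : ℝ} (hT : 0 < T) {X P : ℝ → RSp d} (h : IsShellCurve V T X P)
    (hmin : agmonLength V X 0 T = agmonDist V (X T) (X 0))
    (hu : ∃ q, IsMinGeodesic V (X 0) (X T) q ∧
      ∀ q', IsMinGeodesic V (X 0) (X T) q' → EqOn q q' (Icc 0 1)) :
    agmonLog V (X 0) (X T) = (agmonDist V (X T) (X 0) / (1 - V (X 0) ^ 2)) • P 0 := by
  obtain ⟨s, hs0, hs⟩ := exists_shell_length hV.continuous hV0 hT.le
    (fun t ht => (h t ht).2.1.continuousWithinAt)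
  have hD := h.agmonLength_eq hV0 hg hV.continuous hT hs0 hs
  obtain ⟨hpos, q, w, hq, hq1, hqw⟩ := h.exists_geodesic hV hV0 hg hT hs0 hs
  rw [isIntegralCurveFrom_iff zero_le_one] at hq
  have hqd : ∀ t ∈ Icc (0 : ℝ) 1, HasDerivWithinAt q (w t) (Icc 0 1) t := fun t ht =>
    (ContinuousLinearMap.fst ℝ (RSp d) (RSp d)).hasFDerivAt.comp_hasDerivWithinAt t (hq.2 t ht).2
  have hmg : IsMinGeodesic V (X 0) (X T) q := by
    refine ⟨⟨w, fun t ht => (hq.2 t ht).2⟩, congrArg Prod.fst hq.1, hq1, ?_⟩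
    rw [agmonLength_eq_integral zero_le_one hqd (f := fun _ => s T)
      fun t ht => ⟨hpos.le, hqw t ht⟩, ← hmin, hD]
    simp
  have hex : ∃ q, IsMinGeodesic V (X 0) (X T) q := ⟨q, hmg⟩
  obtain ⟨q₀, -, huniq⟩ := hu
  -- Uniqueness identifies the geodesic chosen in `agmonLog` with the reparametrized shell curve.
  have hEq : EqOn hex.choose q (Icc 0 1) := fun t ht =>
    (huniq _ hex.choose_spec ht).symm.trans (huniq _ hmg ht)
  have h01 := left_mem_Icc.2 (zero_le_one (α := ℝ))
  rw [agmonLog, dif_pos hex, derivWithin_congr hEq (hEq h01),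
    (hqd 0 h01).derivWithin (uniqueDiffOn_Icc zero_lt_one 0 h01), ← hmin, hD]
  exact congrArg Prod.snd hq.1

end Comparison

/-! ### Bordered determinants and the Riemannian determinant -/

section Determinant

variable {d : ℕ}

open Matrix in
/-- The determinant of a bordered matrix that is, on the orthogonal complement of the border, a
multiple of `L` up to multiples of the other border. -/
lemma det_bordered {L M : Matrix (Fin d) (Fin d) ℝ} {p c : Fin d → ℝ} {a α β : ℝ} (ha : a ≠ 0)
    (hα : α ≠ 0) (hβ : β ≠ 0) (hp : p ⬝ᵥ p ≠ 0)
    (hM : ∀ θ, p ⬝ᵥ θ = 0 → M *ᵥ θ = a • L *ᵥ θ + (c ⬝ᵥ θ) • L *ᵥ p) :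
    (fromBlocks 0 (of fun (_ : Unit) j => -(β * p j)) (of fun i (_ : Unit) => α * (L *ᵥ p) i)
      M).det = β * α * (p ⬝ᵥ p) * (a ^ d / a) * L.det := by
  -- `M` is unconstrained on `p`; `z` collects the discrepancy there, so that M = aL + (Lp)cᵀ + zpᵀ.
  set z : Fin d → ℝ := (p ⬝ᵥ p)⁻¹ • (M *ᵥ p - a • L *ᵥ p - (c ⬝ᵥ p) • L *ᵥ p) with hz
  have hMeq : M = a • L + vecMulVec (L *ᵥ p) c + vecMulVec z p := by
    refine Matrix.toLin'.injective (LinearMap.ext fun θ => ?_)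
    simp only [toLin'_apply]
    set t := (p ⬝ᵥ θ) / (p ⬝ᵥ p)
    have ht : p ⬝ᵥ (θ - t • p) = 0 := by
      rw [dotProduct_sub, dotProduct_smul, smul_eq_mul, div_mul_cancel₀ _ hp, sub_self]
    have h1 := hM _ ht
    rw [mulVec_sub, mulVec_smul] at h1
    have h2 : M *ᵥ p = a • L *ᵥ p + (c ⬝ᵥ p) • L *ᵥ p + (p ⬝ᵥ p) • z := by
      rw [hz, smul_smul, mul_inv_cancel₀ hp, one_smul]; abel
    have h3 : M *ᵥ θ = t • M *ᵥ p + (a • L *ᵥ (θ - t • p) + (c ⬝ᵥ (θ - t • p)) • L *ᵥ p) := by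
      rw [← h1]; abel
    have h4 : t * (p ⬝ᵥ p) = p ⬝ᵥ θ := div_mul_cancel₀ _ hp
    rw [h3, h2, mulVec_sub, mulVec_smul, dotProduct_sub, dotProduct_smul, add_mulVec, add_mulVec,
      vecMulVec_mulVec, vecMulVec_mulVec, smul_mulVec]
    ext i
    simp only [Pi.add_apply, Pi.smul_apply, Pi.sub_apply, smul_eq_mul, op_smul_eq_smul]
    linear_combination z i * h4
  -- The two rank one terms are multiples of the border row and of the border column, so unipotent
  -- factors remove them.
  have hfac : fromBlocks (0 : Matrix Unit Unit ℝ) (of fun (_ : Unit) j => -(β * p j))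
      (of fun i (_ : Unit) => α * (L *ᵥ p) i) M =
      fromBlocks 1 0 (of fun i (_ : Unit) => -(β⁻¹ * z i)) 1 *
      (fromBlocks 0 (of fun (_ : Unit) j => -(β * p j)) (of fun i (_ : Unit) => α * (L *ᵥ p) i)
        (a • L) * fromBlocks 1 (of fun (_ : Unit) j => α⁻¹ * c j) 0 1) := by
    rw [fromBlocks_multiply, fromBlocks_multiply]
    simp only [Matrix.zero_mul, Matrix.mul_zero, Matrix.mul_one, Matrix.one_mul, add_zero, zero_add]
    congr 1
    rw [hMeq]
    ext i j
    simp only [Matrix.add_apply, Matrix.smul_apply, vecMulVec_apply, Matrix.mul_apply, of_apply, Finset.univ_unique,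
      Finset.sum_singleton, smul_eq_mul]
    field_simp
    ring
  -- The border column is a multiple of (aL)p. A column operation clears it and leaves the nonzero
  -- corner entry (βα/a) p·p.
  have hmid : fromBlocks (0 : Matrix Unit Unit ℝ) (of fun (_ : Unit) j => -(β * p j))
      (of fun i (_ : Unit) => α * (L *ᵥ p) i) (a • L) *
      fromBlocks 1 0 (of fun i (_ : Unit) => -(α / a * p i)) 1 =
      fromBlocks (of fun _ _ => β * α / a * (p ⬝ᵥ p)) (of fun (_ : Unit) j => -(β * p j)) 0
        (a • L) := by
    rw [fromBlocks_multiply]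
    simp only [Matrix.mul_zero, Matrix.mul_one, zero_add]
    congr 1
    · ext i j
      simp only [mul_apply, of_apply, dotProduct, Finset.mul_sum]
      exact Finset.sum_congr rfl fun k _ => by field_simp
    · ext i j
      simp only [Matrix.add_apply, Matrix.smul_apply, Matrix.mul_apply, of_apply, mulVec, dotProduct, Finset.mul_sum,
        Matrix.zero_apply, smul_eq_mul, ← Finset.sum_add_distrib]
      exact Finset.sum_eq_zero fun k _ => by field_simp; ring
  have hdet := congrArg Matrix.det hmid
  rw [det_mul, det_fromBlocks_zero₁₂, det_one, det_one, one_mul, mul_one, det_fromBlocks_zero₂₁,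
    det_unique (n := Unit), det_smul, Fintype.card_fin] at hdet
  rw [hfac, det_mul, det_mul, det_fromBlocks_zero₁₂, det_fromBlocks_zero₂₁, hdet]
  simp only [det_one, of_apply]
  ring

/-- The frames are rescaled coordinate frames: each entry acquires the factor g(x) from the scalar
product and g(x)^(−1/2) g(y)^(−1/2) from the frames. -/
lemma agmonDet_eq {V : RSp d → ℝ} (x y : RSp d) (hx : 0 < 1 - V x ^ 2) (L : RSp d →L[ℝ] RSp d) :
    agmonDet V y x L = (√(1 - V x ^ 2) / √(1 - V y ^ 2)) ^ d *
      (Matrix.of fun i j => L (EuclideanSpace.single j 1) i).det := by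
  have : (Matrix.of fun i j => agmonInner V x (agmonFrame V x i) (L (agmonFrame V y j))) =
      (√(1 - V x ^ 2) / √(1 - V y ^ 2)) •
        Matrix.of fun i j => L (EuclideanSpace.single j (1 : ℝ)) i := by
    ext i j
    simp only [Matrix.of_apply, Matrix.smul_apply, agmonInner_eq, agmonFrame, map_smul,
      real_inner_smul_left, real_inner_smul_right, EuclideanSpace.inner_single_left, smul_eq_mul]
    have h := Real.sq_sqrt hx.le
    have h' : √(1 - V x ^ 2) ≠ 0 := (Real.sqrt_pos.2 hx).ne'
    nth_rewrite 1 [← h]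
    simp
    field_simp
  rw [agmonDet, this, Matrix.det_smul, Fintype.card_fin]

lemma rpow_half_sub {g : ℝ} (hg : 0 < g) (d : ℕ) : g ^ (((d : ℝ) - 2) / 2) = √g ^ d / g := by
  rw [show ((d : ℝ) - 2) / 2 = (1 / 2) * d - 1 by ring, Real.rpow_sub_one hg.ne', Real.rpow_mul hg.le,
    Real.rpow_natCast, Real.sqrt_eq_rpow]

end Determinant

/-! ### Variations of the initial momentum on the energy sphere -/

section Main

variable {d : ℕ}

/-- A curve on the sphere through `p` with velocity `θ ⟂ p`. -/
lemma exists_sphere_curve {p θ : RSp d} (hp : p ≠ 0) (hθ : ⟪p, θ⟫ = 0) :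
    ∃ c : ℝ → RSp d, c 0 = p ∧ HasDerivAt c θ 0 ∧ ∀ ε, ‖c ε‖ ^ 2 = ‖p‖ ^ 2 := by
  -- Chosen so that |p + εθ|² = |p|²(1 + κε²); dividing by the root of 1 + κε² returns to the sphere
  -- without changing the velocity at ε = 0.
  set κ := ‖θ‖ ^ 2 / ‖p‖ ^ 2
  have hpos : ∀ ε : ℝ, 0 < 1 + κ * ε ^ 2 := fun ε => by positivity
  have hp' : ‖p‖ ^ 2 ≠ 0 := by positivity
  refine ⟨fun ε => (√(1 + κ * ε ^ 2))⁻¹ • (p + ε • θ), by simp, ?_, fun ε => ?_⟩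
  · have h1 : HasDerivAt (fun ε : ℝ => 1 + κ * ε ^ 2) 0 0 := by
      simpa using ((hasDerivAt_pow 2 (0 : ℝ)).const_mul κ).const_add 1
    have h2 := (h1.sqrt (hpos 0).ne').fun_inv (Real.sqrt_pos.2 (hpos 0)).ne'
    have h3 : HasDerivAt (fun ε : ℝ => p + ε • θ) θ 0 := by
      simpa using ((hasDerivAt_id (0 : ℝ)).smul_const θ).const_add p
    simpa using h2.fun_smul h3
  · rw [norm_smul, mul_pow, Real.norm_eq_abs, sq_abs, inv_pow, Real.sq_sqrt (hpos ε).le,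
      norm_add_sq_real, real_inner_smul_right, hθ, norm_smul, mul_pow, Real.norm_eq_abs, sq_abs]
    rw [inv_mul_eq_iff_eq_mul₀ (hpos ε).ne']
    simp only [κ]
    field_simp
    ring

end Main

/-! ### Derivatives of the flows along the minimizing trajectory -/

section Main

variable {d : ℕ}

/-- The matrix of a linear map in the standard basis. -/
noncomputable def stdMatrix (L : RSp d →L[ℝ] RSp d) : Matrix (Fin d) (Fin d) ℝ :=
  Matrix.of fun i j => L (EuclideanSpace.single j 1) i

lemma clm_apply_eq_sum {E : Type*} [NormedAddCommGroup E] [NormedSpace ℝ E] (L : RSp d →L[ℝ] E)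
    (θ : RSp d) : L θ = ∑ k, θ k • L (EuclideanSpace.single k 1) := by
  conv_lhs => rw [← (EuclideanSpace.basisFun (Fin d) ℝ).sum_repr θ]
  simp

lemma stdMatrix_mulVec (L : RSp d →L[ℝ] RSp d) (θ : RSp d) :
    Matrix.mulVec (stdMatrix L) θ.ofLp = (L θ).ofLp := by
  rw [clm_apply_eq_sum]
  ext i
  simp [Matrix.mulVec, dotProduct, stdMatrix, mul_comm]

lemma PotentialHyp.sq_lt_one {V : RSp d → ℝ} (hV : PotentialHyp V) (x : RSp d) :
    V x < 0 ∧ 0 < 1 - V x ^ 2 := by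
  obtain ⟨-, δ, h0, -, h⟩ := hV
  constructor <;> nlinarith [h x]

/-- The bordered determinant for complex position derivatives that come from a real matrix. -/
lemma det_borderedMatrix_ofReal (v u : RSp d) (M : Matrix (Fin d) (Fin d) ℝ) :
    (borderedMatrix v u (M.map Complex.ofReal)).det =
      ((Matrix.fromBlocks 0 (Matrix.of fun (_ : Unit) j => -(v j))
        (Matrix.of fun i (_ : Unit) => u i) M).det : ℂ) := by
  rw [← Complex.ofRealHom_eq_coe, RingHom.map_det]
  congr 1
  ext (i | i) (j | j) <;> simp [borderedMatrix]

lemma isOpen_shellDomain {φ : RSp d → ℝ} (hφ : ContDiff ℝ ∞ φ) {Ω : Set (CSp d × CSp d)}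
    (hΩ : IsOpen Ω) :
    IsOpen {ρ : RSp d × RSp d × ℝ | ‖ρ.2.1‖ < 1 ∧ phaseEmbedding φ ρ.1 ρ.2.1 ∈ Ω} := by
  have hG := (contDiff_gradient hφ).continuous
  have hc : Continuous fun ρ : RSp d × RSp d × ℝ => phaseEmbedding φ ρ.1 ρ.2.1 :=
    ((realToCL d).continuous.comp continuous_fst).prodMk
      (((realToCL d).continuous.comp
        ((continuous_fst.comp continuous_snd).sub (hG.comp continuous_fst))).const_smul Complex.I)
  exact (isOpen_lt (continuous_fst.comp continuous_snd).norm continuous_const).inter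
    (hΩ.preimage hc)

/-- Near the initial momentum of a zero energy trajectory the real Hamiltonian flow, extended by
the Agmon length, computes both the complex flow and the exponential map. -/
lemma exists_shellFlow {V φ : RSp d → ℝ} {Vc φc : CSp d → ℂ} (hV : ContDiff ℝ ∞ V)
    (hV0 : ∀ x, V x < 0) (hg : ∀ x, 0 < 1 - V x ^ 2) (hφ : ContDiff ℝ ∞ φ)
    (hVc : IsAlmostAnalyticExtension V Vc) (hφc : IsAlmostAnalyticExtension φ φc)
    {Ω : Set (CSp d × CSp d)} (hΩ : IsSymbolDomain φc Ω) {T : ℝ} (hT : 0 < T) {X P : ℝ → RSp d}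
    (h : IsShellCurve V T X P) {s : ℝ → ℝ} (hs0 : s 0 = 0)
    (hs : ∀ t ∈ Icc 0 T, HasDerivWithinAt s ((1 - V (X t) ^ 2) / (-V (X t))) (Icc 0 T) t)
    (hP1 : ∀ t ∈ Icc 0 T, ‖P t‖ < 1) (hPφ : ∀ t ∈ Icc 0 T, gradient φ (X t) = P t) :
    ∃ Z : RSp d → RSp d × ℝ, DifferentiableAt ℝ Z (P 0) ∧ Z (P 0) = (X T, s T) ∧
      ∀ᶠ p in 𝓝 (P 0),
        qPlus Vc φc Ω T (realToC (X 0)) (Complex.I • realToC (p - P 0)) = realToC (Z p).1 ∧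
        (‖p‖ ^ 2 = 1 - V (X 0) ^ 2 →
          agmonExp V (X 0) (((Z p).2 / (1 - V (X 0) ^ 2)) • p) = (Z p).1) := by
  have hVd := hV.differentiable (by simp)
  -- On this domain one real integral curve serves both purposes: its embedding stays in `Ω`, and
  -- its momentum stays in the unit ball.
  set ΩR := {ρ : RSp d × RSp d × ℝ | ‖ρ.2.1‖ < 1 ∧ phaseEmbedding φ ρ.1 ρ.2.1 ∈ Ω}
  have hΩo : IsOpen ΩR := isOpen_shellDomain hφ hΩ.1
  have hF : ContDiffOn ℝ 1 (shellField V) ΩR := contDiffOn_shellField hV hV0 fun ρ hρ => hρ.1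
  have hcurve : IsIntegralCurveFrom (shellField V) ΩR T (X 0, P 0, 0)
      (fun t => (X t, P t, s t)) := by
    rw [isIntegralCurveFrom_iff hT.le]
    refine ⟨by rw [hs0], fun t ht => ⟨⟨hP1 t ht, ?_⟩, ?_⟩⟩
    · have := hΩ.2.1 (X t) 0
      simpa [phaseEmbedding, hPφ t ht, ← realToCL_apply] using this
    · obtain ⟨h1, h2, h3⟩ := h t ht
      rw [shellField, sqrt_eq_of_shell (hV0 _) h1]
      exact h2.prodMk (h3.prodMk (hs t ht))
  obtain ⟨hdom, J, -, -, hJ⟩ := exists_hasFDerivAt_flowAt hΩo hF hT.le hcurve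
  set Z₀ : RSp d → RSp d × RSp d × ℝ := fun p => flowAt (shellField V) ΩR T (X 0, p, 0)
  have hin : HasFDerivAt (fun p : RSp d => ((X 0, p, 0) : RSp d × RSp d × ℝ))
      ((0 : RSp d →L[ℝ] RSp d).prod ((ContinuousLinearMap.id ℝ (RSp d)).prod 0)) (P 0) :=
    (hasFDerivAt_const _ _).prodMk ((hasFDerivAt_id _).prodMk (hasFDerivAt_const _ _))
  have hZ₀ : DifferentiableAt ℝ Z₀ (P 0) :=
    (HasFDerivAt.comp (P 0) (g := flowAt (shellField V) ΩR T) hJ hin).differentiableAt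
  refine ⟨fun p => ((Z₀ p).1, (Z₀ p).2.2), hZ₀.fst.prodMk hZ₀.snd.snd, ?_, ?_⟩
  · simp only [Z₀, hcurve.flowAt_eq hΩo hF hT.le]
  filter_upwards [hin.continuousAt.eventually hdom] with p ⟨c, hc⟩
  have hZp : Z₀ p = c T := hc.flowAt_eq hΩo hF hT.le
  obtain ⟨hc0, hcd⟩ := (isIntegralCurveFrom_iff hT.le).1 hc
  have hX : ∀ t ∈ Icc 0 T, HasDerivWithinAt (fun t => (c t).1)
      ((√(1 - ‖(c t).2.1‖ ^ 2))⁻¹ • (c t).2.1) (Icc 0 T) t := fun t ht => (hcd t ht).2.fst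
  have hP : ∀ t ∈ Icc 0 T, HasDerivWithinAt (fun t => (c t).2.1)
      (gradient V (c t).1) (Icc 0 T) t := fun t ht => (hcd t ht).2.snd.fst
  have hS : ∀ t ∈ Icc 0 T, HasDerivWithinAt (fun t => (c t).2.2)
      ((1 - V (c t).1 ^ 2) / (-V (c t).1)) (Icc 0 T) t := fun t ht => (hcd t ht).2.snd.snd
  have h1 : ∀ t ∈ Icc 0 T, ‖(c t).2.1‖ < 1 := fun t ht => (hcd t ht).1.1
  have h0 := left_mem_Icc.2 hT.le
  rw [hZp]
  constructor
  · have hq := isIntegralCurveFrom_phaseEmbedding hV hφ hVc hφc hΩ hT.le hX hP h1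
      fun t ht => (hcd t ht).1.2
    rw [hc0] at hq
    simp only [phaseEmbedding, hPφ 0 h0] at hq
    rw [qPlus, hq.flowAt_eq hΩ.1 (contDiffOn_complexHamField hVc.almostHolomorphic
      hφc.almostHolomorphic hΩ) hT.le]
  · intro hp
    have hp1 : ‖p‖ < 1 := by simpa [hc0] using h1 0 h0
    have hsh : IsShellCurve V T (fun t => (c t).1) (fun t => (c t).2.1) :=
      isShellCurve_of_energy hVd hV0 hX hP h1
        (by simpa only [hc0] using (diracHam_eq_zero_iff (hV0 _) hp1).2 hp)
    have := hsh.agmonExp_eq hV hV0 hg hT (s := fun t => (c t).2.2) (by rw [hc0]) hS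
    simpa only [hc0] using this

/-- The position part of the complex flow is differentiable on the zero section along a real
trajectory, with complex linear derivative. -/
lemma exists_hasFDerivAt_qPlus {V φ : RSp d → ℝ} {Vc φc : CSp d → ℂ} (hV : ContDiff ℝ ∞ V)
    (hV0 : ∀ x, V x < 0) (hφ : ContDiff ℝ ∞ φ)
    (hVc : IsAlmostAnalyticExtension V Vc) (hφc : IsAlmostAnalyticExtension φ φc)
    {Ω : Set (CSp d × CSp d)} (hΩ : IsSymbolDomain φc Ω) {T : ℝ} (hT : 0 < T) {X P : ℝ → RSp d}
    (h : IsShellCurve V T X P) (hP1 : ∀ t ∈ Icc 0 T, ‖P t‖ < 1)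
    (hPφ : ∀ t ∈ Icc 0 T, gradient φ (X t) = P t) :
    (∀ᶠ η in 𝓝 (0 : CSp d), InFlowDomain (complexHamField Vc φc) Ω T (realToC (X 0), η)) ∧
    ∃ L : CSp d →L[ℝ] CSp d, (∀ v, L (Complex.I • v) = Complex.I • L v) ∧
      HasFDerivAt (fun η => qPlus Vc φc Ω T (realToC (X 0)) η) L 0 := by
  have hF := contDiffOn_complexHamField hVc.almostHolomorphic hφc.almostHolomorphic hΩ
  have hemb : ∀ t ∈ Icc 0 T, phaseEmbedding φ (X t) (P t) = (realToC (X t), 0) := fun t ht => by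
    simp [phaseEmbedding, hPφ t ht, ← realToCL_apply]
  have hmem : ∀ t, (realToC (X t), (0 : CSp d)) ∈ Ω := fun t => by
    simpa [← realToCL_apply] using hΩ.2.1 (X t) 0
  have hcurve := isIntegralCurveFrom_phaseEmbedding hV hφ hVc hφc hΩ hT.le
    (fun t ht => by rw [sqrt_eq_of_shell (hV0 _) (h t ht).1]; exact (h t ht).2.1)
    (fun t ht => (h t ht).2.2) hP1 (fun t ht => by rw [hemb t ht]; exact hmem t)
  have hcc : ContinuousOn (fun t => phaseEmbedding φ (X t) (P t)) (Icc 0 T) := fun t ht =>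
    (((isIntegralCurveFrom_iff hT.le).1 hcurve).2 t ht).2.continuousWithinAt
  rw [hemb 0 (left_mem_Icc.2 hT.le)] at hcurve
  obtain ⟨hdom, J, hJ0, hJ, hJT⟩ := exists_hasFDerivAt_flowAt hΩ.1 hF hT.le hcurve
  have hin : HasFDerivAt (fun η : CSp d => (realToC (X 0), η))
      (ContinuousLinearMap.inr ℝ (CSp d) (CSp d)) 0 := hasFDerivAt_prodMk_right _ _
  refine ⟨hin.continuousAt.eventually hdom,
    (ContinuousLinearMap.fst ℝ (CSp d) (CSp d)).comp
      ((J T).comp (ContinuousLinearMap.inr ℝ (CSp d) (CSp d))), fun v => ?_, ?_⟩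
  · have hA : ContinuousOn (fun t => fderiv ℝ (complexHamField Vc φc)
        (phaseEmbedding φ (X t) (P t))) (Icc 0 T) :=
      (hF.continuousOn_fderiv_of_isOpen hΩ.1 le_rfl).comp hcc fun t ht => by
        rw [hemb t ht]; exact hmem t
    -- At the real points of the curve the field is complex differentiable, so the linearized
    -- coefficients commute with multiplication by i.
    have := linear_solution_commute hT.le hA hJ0 hJ
      (Complex.I • ContinuousLinearMap.id ℝ (CSp d × CSp d)) (fun t ht v => by
        have hd := differentiableAt_complexHamField hVc.almostHolomorphic hφc.almostHolomorphic hΩ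
          (hmem t)
        rw [hemb t ht, hd.fderiv_restrictScalars ℝ]
        simp) (0, v)
    have h2 := congrArg Prod.fst this
    simpa using h2
  · exact (ContinuousLinearMap.fst ℝ (CSp d) (CSp d)).hasFDerivAt.comp (0 : CSp d)
      (HasFDerivAt.comp (0 : CSp d) (g := flowAt (complexHamField Vc φc) Ω T) hJT hin)

end Main

/-- The velocity of a shell curve at its end point through the differential of the exponential
map. -/
lemma IsShellCurve.fderiv_agmonExp_apply {d : ℕ} {V : RSp d → ℝ} (hV : ContDiff ℝ ∞ V)
    (hV0 : ∀ x, V x < 0) (hg : ∀ x, 0 < 1 - V x ^ 2) {T : ℝ} (hT : 0 < T) {X P : ℝ → RSp d}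
    (h : IsShellCurve V T X P) {s : ℝ → ℝ} (hs0 : s 0 = 0)
    (hs : ∀ t ∈ Icc 0 T, HasDerivWithinAt s ((1 - V (X t) ^ 2) / (-V (X t))) (Icc 0 T) t)
    {L : RSp d →L[ℝ] RSp d}
    (hL : HasFDerivAt (agmonExp V (X 0)) L ((s T / (1 - V (X 0) ^ 2)) • P 0)) :
    ((1 - V (X T) ^ 2) / (-V (X T)) / (1 - V (X 0) ^ 2)) • L (P 0) = (-V (X T))⁻¹ • P T := by
  have hTm := right_mem_Icc.2 hT.le
  -- Every truncation of the curve to [0, t] is a shell curve, so X(t) is the exponential of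
  -- (s(t)/g) P(0) with g = 1 − V² at the starting point. Time zero is left out since the
  -- reparametrization needs t > 0; the one-sided derivative at `T` suffices.
  have h1 : HasDerivWithinAt (fun t => agmonExp V (X 0) ((s t / (1 - V (X 0) ^ 2)) • P 0))
      (L (((1 - V (X T) ^ 2) / (-V (X T)) / (1 - V (X 0) ^ 2)) • P 0)) (Ioc 0 T) T :=
    hL.comp_hasDerivWithinAt T (f := fun t => (s t / (1 - V (X 0) ^ 2)) • P 0)
      ((((hs T hTm).mono Ioc_subset_Icc_self).div_const _).smul_const _)
  have heq : ∀ t ∈ Ioc 0 T, X t = agmonExp V (X 0) ((s t / (1 - V (X 0) ^ 2)) • P 0) := by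
    intro t ht
    have hsub : Icc 0 t ⊆ Icc 0 T := Icc_subset_Icc_right ht.2
    have hsh : IsShellCurve V t X P := fun r hr =>
      ⟨(h r (hsub hr)).1, (h r (hsub hr)).2.1.mono hsub, (h r (hsub hr)).2.2.mono hsub⟩
    exact (hsh.agmonExp_eq hV hV0 hg ht.1 hs0 fun r hr => (hs r (hsub hr)).mono hsub).symm
  have h2 := h1.congr heq (heq T ⟨hT, le_rfl⟩)
  rw [← map_smul]
  exact UniqueDiffWithinAt.eq_deriv _ (uniqueDiffOn_Ioc 0 T T ⟨hT, le_rfl⟩) h2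
    ((h T hTm).2.1.mono Ioc_subset_Icc_self)

theorem mainTheorem5 {d : ℕ} (V : RSp d → ℝ) (hV : PotentialHyp V)
    (x y : RSp d) (hxy : GeodesicHyp V x y)
    (τ : ℝ) (hτ : 0 < τ) (γ ϖ : ℝ → RSp d) (hγ : IsZeroEnergyTrajectory V τ γ ϖ)
    (hγ0 : γ 0 = y) (hγτ : γ τ = x) (hmin : agmonLength V γ 0 τ = agmonDist V x y)
    (K₀ : Set (RSp d)) (φ : RSp d → ℝ) (hφ : IsAgmonWeight V y (γ '' Set.Icc 0 τ) K₀ φ)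
    (Vc φc : CSp d → ℂ) (hVc : IsAlmostAnalyticExtension V Vc)
    (hφc : IsAlmostAnalyticExtension φ φc)
    (Ω : Set (CSp d × CSp d)) (hΩ : IsSymbolDomain φc Ω) :
    (∀ᶠ η in nhds (0 : CSp d), InFlowDomain (complexHamField Vc φc) Ω τ (realToC y, η)) ∧
    DifferentiableAt ℝ (fun η => qPlus Vc φc Ω τ (realToC y) η) 0 ∧
    (∀ᶠ v in nhds (agmonLog V y x), InFlowDomain (geodesicField V) Set.univ 1 (y, v)) ∧
    agmonExp V y (agmonLog V y x) = x ∧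
    DifferentiableAt ℝ (agmonExp V y) (agmonLog V y x) ∧
    Matrix.det (borderedMatrix (derivWithin γ (Set.Icc 0 τ) 0) (derivWithin γ (Set.Icc 0 τ) τ)
        (Complex.I • wJacobian (fun η => qPlus Vc φc Ω τ (realToC y) η) 0)) =
      ((agmonDist V x y ^ (d - 1) * agmonDet V y x (fderiv ℝ (agmonExp V y) (agmonLog V y x)) /
        (|V x| * |V y| * (1 - V x ^ 2) ^ (((d : ℝ) - 2) / 2)
          * (1 - V y ^ 2) ^ (((d : ℝ) - 2) / 2)) : ℝ) : ℂ) := by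
  subst hγ0 hγτ
  obtain ⟨hne, hu, hbij⟩ := hxy
  obtain ⟨⟨hφs, -⟩, -, -, hφw, hφd⟩ := hφ
  have hVs : ContDiff ℝ ∞ V := hV.1.1
  have hV0 : ∀ x, V x < 0 := fun x => (hV.sq_lt_one x).1
  have hg : ∀ x, 0 < 1 - V x ^ 2 := fun x => (hV.sq_lt_one x).2
  have h0m := left_mem_Icc.2 hτ.le
  have hτm := right_mem_Icc.2 hτ.le
  have hsh := hγ.isShellCurve (hVs.differentiable (by simp)) hV0
  obtain ⟨s, hs0, hs⟩ := exists_shell_length hVs.continuous hV0 hτ.le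
    (fun t ht => (hsh t ht).2.1.continuousWithinAt)
  have hD : s τ = agmonDist V (γ τ) (γ 0) :=
    (hsh.agmonLength_eq hV0 hg hVs.continuous hτ hs0 hs).symm.trans hmin
  have hDpos : 0 < s τ := (hsh.exists_geodesic hVs hV0 hg hτ hs0 hs).1
  have hP1 : ∀ t ∈ Icc 0 τ, ‖ϖ t‖ < 1 := fun t ht => (hγ t ht).1
  have hPφ : ∀ t ∈ Icc 0 τ, gradient φ (γ t) = ϖ t :=
    hsh.gradient_eq hVs hV0 hφs (fun x => (hφw x).1) (fun x => (hφw x).2.1) hτ hs0 hs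
      ((hφd _ (mem_image_of_mem γ hτm)).trans hD.symm)
  have hlog := hsh.agmonLog_eq hVs hV0 hg hτ hmin hu
  rw [← hD] at hlog ⊢
  rw [hlog] at hbij ⊢
  set gy := 1 - V (γ 0) ^ 2 with hgy
  set gx := 1 - V (γ τ) ^ 2 with hgx
  set L := fderiv ℝ (agmonExp V (γ 0)) ((s τ / gy) • ϖ 0)
  have hgy0 : 0 < gy := hg _
  have hgx0 : 0 < gx := hg _
  have hd : 0 < d := by
    refine Nat.pos_of_ne_zero fun h => hne ?_
    subst h
    exact Subsingleton.elim _ _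
  -- `fderiv` defaults to zero at a point of nondifferentiability, and the zero map cannot be
  -- injective on a space with two distinct points.
  have hEd : DifferentiableAt ℝ (agmonExp V (γ 0)) ((s τ / gy) • ϖ 0) := by
    by_contra hnd
    have hL0 : L = 0 := fderiv_zero_of_not_differentiableAt hnd
    rw [hL0] at hbij
    exact hne (hbij.1 (by simp))
  have hE : HasFDerivAt (agmonExp V (γ 0)) L ((s τ / gy) • ϖ 0) := hEd.hasFDerivAt
  obtain ⟨hdomQ, Q, hQI, hQ⟩ := exists_hasFDerivAt_qPlus hVs hV0 hφs hVc hφc hΩ hτ hsh hP1 hPφ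
  obtain ⟨Z, hZd, hZ0, hZ⟩ :=
    exists_shellFlow hVs hV0 hg hφs hVc hφc hΩ hτ hsh hs0 hs hP1 hPφ
  have hdomE : ∀ᶠ v in 𝓝 ((s τ / gy) • ϖ 0),
      InFlowDomain (geodesicField V) univ 1 (γ 0, v) := by
    obtain ⟨-, q, w, hq, -⟩ := hsh.exists_geodesic hVs hV0 hg hτ hs0 hs
    have := (exists_hasFDerivAt_flowAt isOpen_univ (contDiff_geodesicField hVs hg).contDiffOn
      zero_le_one hq).1
    exact (Continuous.prodMk_right (γ 0)).continuousAt.eventually this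
  refine ⟨hdomQ, hQ.differentiableAt, hdomE, hsh.agmonExp_eq hVs hV0 hg hτ hs0 hs, hEd, ?_⟩
  set A : RSp d →L[ℝ] RSp d := (ContinuousLinearMap.fst ℝ _ _).comp (fderiv ℝ Z (ϖ 0))
  set B : RSp d →L[ℝ] ℝ := (ContinuousLinearMap.snd ℝ _ _).comp (fderiv ℝ Z (ϖ 0))
  have hZA : HasFDerivAt (fun p => (Z p).1) A (ϖ 0) := hZd.hasFDerivAt.fst
  have hZB : HasFDerivAt (fun p => (Z p).2) B (ϖ 0) := hZd.hasFDerivAt.snd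
  have hQA : ∀ θ, Q (Complex.I • realToC θ) = realToC (A θ) := by
    have h1 : HasFDerivAt (fun p => qPlus Vc φc Ω τ (realToC (γ 0))
        (Complex.I • realToC (p - ϖ 0)))
        (Q.comp (Complex.I • realToCL d)) (ϖ 0) := by
      have hi : HasFDerivAt (fun p => Complex.I • realToC (p - ϖ 0))
          (Complex.I • realToCL d) (ϖ 0) := by
        have := ((realToCL d).hasFDerivAt (x := ϖ 0)).sub_const (realToCL d (ϖ 0))
        simp only [← map_sub] at this
        exact this.const_smul Complex.I
      refine HasFDerivAt.comp (ϖ 0) (g := fun η => qPlus Vc φc Ω τ (realToC (γ 0)) η) ?_ hi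
      simpa [← realToCL_apply] using hQ
    have h2 : HasFDerivAt (fun p => realToC (Z p).1) ((realToCL d).comp A) (ϖ 0) :=
      (realToCL d).hasFDerivAt.comp (ϖ 0) hZA
    have h3 := h1.unique (h2.congr_of_eventuallyEq (hZ.mono fun p hp => hp.1))
    intro θ
    simpa using congrArg (fun L => L θ) h3
  -- As `Q` is complex linear, the Wirtinger Jacobian is its ordinary matrix, and `hQA` makes i
  -- times it real.
  have hJac : Complex.I • wJacobian (fun η => qPlus Vc φc Ω τ (realToC (γ 0)) η) 0 =
      (stdMatrix A).map Complex.ofReal := by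
    ext j k
    have hk := congrArg (fun v => v.ofLp j) (hQA (EuclideanSpace.single k 1))
    simp only [realToC_single, hQI, PiLp.smul_apply, realToC_apply, smul_eq_mul] at hk
    simp only [Matrix.smul_apply, wJacobian, Matrix.of_apply, hQ.fderiv, Matrix.map_apply,
      stdMatrix, smul_eq_mul, ← hk]
    rw [← I_smul_single, hQI, PiLp.smul_apply, smul_eq_mul]
    linear_combination (-(1 / 2) * Complex.I * Q (EuclideanSpace.single k 1) j) * Complex.I_sq
  have hp0n : ‖ϖ 0‖ ^ 2 = gy := (hsh 0 h0m).1
  have hp0 : ϖ 0 ≠ 0 := by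
    intro h
    rw [h, norm_zero] at hp0n
    exact hgy0.ne (by simpa using hp0n)
  -- The exponential formula for X(p) holds only on the energy sphere, so only tangential θ are
  -- available. The term with `B` comes from the variation of the Agmon length.
  have hperp : ∀ θ, ⟪ϖ 0, θ⟫ = 0 → A θ = (s τ / gy) • L θ + (B θ / gy) • L (ϖ 0) := by
    intro θ hθ
    obtain ⟨c, hc0, hcd, hcn⟩ := exists_sphere_curve hp0 hθ
    have hcA : HasDerivAt (fun ε => (Z (c ε)).1) (A θ) 0 :=
      HasFDerivAt.comp_hasDerivAt (0 : ℝ) (l := fun p => (Z p).1) (by rwa [hc0]) hcd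
    have hcB : HasDerivAt (fun ε => (Z (c ε)).2) (B θ) 0 :=
      HasFDerivAt.comp_hasDerivAt (0 : ℝ) (l := fun p => (Z p).2) (by rwa [hc0]) hcd
    have hcv := (hcB.div_const gy).fun_smul hcd
    have hcE : HasDerivAt (fun ε => agmonExp V (γ 0) (((Z (c ε)).2 / gy) • c ε)) _ 0 :=
      HasFDerivAt.comp_hasDerivAt (0 : ℝ) (l := agmonExp V (γ 0)) (l' := L)
        (by rw [hc0, hZ0]; exact hE) hcv
    have hev : ∀ᶠ ε in 𝓝 (0 : ℝ),
        (Z (c ε)).1 = agmonExp V (γ 0) (((Z (c ε)).2 / gy) • c ε) := by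
      have hcc : Tendsto c (𝓝 0) (𝓝 (ϖ 0)) := by
        simpa [hc0] using hcd.continuousAt.tendsto
      filter_upwards [hcc.eventually hZ] with ε hε
      exact (hε.2 ((hcn ε).trans hp0n)).symm
    have := hcA.unique (hcE.congr_of_eventuallyEq hev)
    rw [this, hc0, hZ0, map_add, map_smul, map_smul]
  have hvx := hsh.fderiv_agmonExp_apply hVs hV0 hg hτ hs0 hs hE
  have hVx := hV0 (γ τ)
  have hVy := hV0 (γ 0)
  have hud := uniqueDiffOn_Icc hτ
  rw [hJac, det_borderedMatrix_ofReal, ((hsh 0 h0m).2.1).derivWithin (hud 0 h0m),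
    ((hsh τ hτm).2.1).derivWithin (hud τ hτm), ← hvx]
  have hnorm : (ϖ 0).ofLp ⬝ᵥ (ϖ 0).ofLp = gy := by
    rw [← hp0n, EuclideanSpace.real_norm_sq_eq]
    exact Finset.sum_congr rfl fun i _ => (sq _).symm
  have hdet := det_bordered (L := stdMatrix L) (M := stdMatrix A) (p := (ϖ 0).ofLp)
    (c := fun k => B (EuclideanSpace.single k 1) / gy) (a := s τ / gy)
    (α := gx / (-V (γ τ)) / gy) (β := (-V (γ 0))⁻¹) (div_pos hDpos hgy0).ne'
    (div_pos (div_pos hgx0 (neg_pos.2 hVx)) hgy0).ne' (inv_pos.2 (neg_pos.2 hVy)).ne'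
    (by rw [hnorm]; exact hgy0.ne') fun θ hθ => by
      have h1 := hperp (WithLp.toLp 2 θ) (by
        have : ⟪ϖ 0, WithLp.toLp 2 θ⟫ = (ϖ 0).ofLp ⬝ᵥ θ := by
          simp [PiLp.inner_apply, dotProduct, mul_comm]
        rw [this, hθ])
      have h2 := congrArg WithLp.ofLp h1
      simp only [WithLp.ofLp_add, WithLp.ofLp_smul, ← stdMatrix_mulVec] at h2
      rw [h2, clm_apply_eq_sum B]
      congr 2
      simp only [smul_eq_mul, dotProduct, Finset.sum_div]
      exact Finset.sum_congr rfl fun k _ => by ring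
  rw [stdMatrix_mulVec, hnorm] at hdet
  have hfin : (Matrix.fromBlocks 0 (Matrix.of fun (_ : Unit) j => -(((-V (γ 0))⁻¹ • ϖ 0) j))
      (Matrix.of fun i (_ : Unit) => ((gx / (-V (γ τ)) / gy) • L (ϖ 0)) i) (stdMatrix A)).det =
      s τ ^ (d - 1) * agmonDet V (γ 0) (γ τ) L / (|V (γ τ)| * |V (γ 0)| *
        gx ^ (((d : ℝ) - 2) / 2) * gy ^ (((d : ℝ) - 2) / 2)) := by
    refine hdet.trans ?_
    rw [agmonDet_eq _ _ hgx0, rpow_half_sub hgx0, rpow_half_sub hgy0, abs_of_neg hVx,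
      abs_of_neg hVy, ← hgx, ← hgy]
    change _ * (stdMatrix L).det = s τ ^ (d - 1) * (_ * (stdMatrix L).det) / _
    -- The truncated exponent `d - 1` is a genuine one because d ≥ 1.
    obtain ⟨n, rfl⟩ := Nat.exists_eq_succ_of_ne_zero hd.ne'
    have hsx := (Real.sqrt_pos.2 hgx0).ne'
    have hsy := (Real.sqrt_pos.2 hgy0).ne'
    have hsy2 : gy ^ (n + 1) = √gy ^ (n + 1) * √gy ^ (n + 1) := by
      rw [← mul_pow, Real.mul_self_sqrt hgy0.le]
    have hVx' := hVx.ne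
    have hVy' := hVy.ne
    simp only [Nat.succ_eq_add_one, Nat.add_sub_cancel, div_pow]
    rw [hsy2]
    field_simp
    ring
  exact_mod_cast hfin
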